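/- **Setting.** Let $\overline M$ be an asymptotically Euclidean (scattering) manifold: a smooth compact manifold with boundary whose interior $M$ carries a Riemannian metric of the form $g=\frac{dx^2}{x^4}+\frac{g'}{x^2}$ near $\partial M$, where $x$ is a boundary defining function and $g'$ is a smooth symmetric 2-tensor on $\overline M$ restricting to a metric on $\partial M$. Let $H^1_{\partial M}(M)$ be the image of the natural map $H^1(\overline M,\partial M)\to H^1(\overline M)$ in (real) de Rham cohomology, regarded as a subspace of $H^1(M)$ by restriction to the interior, and let $d=\dim H^1_{\partial M}(M)$. Let $\Lambda^1C^\infty_{\partial M}(M)$ be the space of closed smooth real 1-forms on $M$ whose class lies in $H^1_{\partial M}(M)$. A form $\theta\in\Lambda^1C^\infty_{\partial M}(M)$ is *integral* if $\int_\sigma\theta\in2\pi\mathbb Z$ for every smooth 1-cycle $\sigma$ in $M$. Let $\boldsymbol\omega=(\omega_1,\dots,\omega_m)$ be a family in $\Lambda^1C^\infty_{\partial M}(M)$ and, for $\xi\in\mathbb Z^m$, write $\xi\cdot\boldsymbol\omega=\sum_k\xi_k\omega_k$. The family $\boldsymbol\omega$ is * *rational* if $\xi\cdot\boldsymbol\omega$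 is integral for some $\xi\in\mathbb Z^m\setminus\{0\}$; * *Liouville* if it is not rational and there are a sequence of integral 1-forms $\theta_j\in\Lambda^1C^\infty_{\partial M}(M)$ and a sequence $\xi_j\in\mathbb Z^m$ with $|\xi_j|\to\infty$ such that $\{|\xi_j|^j(\xi_j\cdot\boldsymbol\omega-\theta_j)\}_j$ is bounded in the Fréchet space of smooth 1-forms on $M$ (all derivatives of the components, in every chart, are bounded on compact sets uniformly in $j$). Let $\sigma_1,\dots,\sigma_{d'}$, with $d'\ge d$, be smooth 1-cycles in $M$ whose classes form a $\mathbb Z$-basis of $H_1(M;\mathbb Z)$ modulo torsion, such that $\int_{\sigma_\ell}\omega=0$ for all $\omega\in\Lambda^1C^\infty_{\partial M}(M)$ and all $d<\ell\le d'$. Let $A(\boldsymbol\omega)$ be the real $d\times m$ matrix with entries $$A(\boldsymbol\omega)_{\ell k}=\frac1{2\pi}\int_{\sigma_\ell}\omega_k,\qquad 1\le\ell\le d,\ 1\le k\le m.$$ A matrix $A\in M_{d\times m}(\mathbb R)$ satisfies the Diophantine condition (DC) if there are constants $C,\rho>0$ such that $$|\eta+A\xi|\ge C\,(|\eta|+|\xi|)^{-\rho}\qquad\text{for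 all }(\xi,\eta)\in(\mathbb Z^m\times\mathbb Z^d)\setminus\{(0,0)\}.$$ **Proposition.** The family $\boldsymbol\omega$ is 1. rational if and only if $A(\boldsymbol\omega)(\mathbb Z^m\setminus\{0\})\cap\mathbb Z^d\ne\varnothing$; 2. Liouville if and only if $\boldsymbol\omega$ is not rational and $A(\boldsymbol\omega)$ does not satisfy (DC). -/

import Mathlib

open scoped Manifold ContDiff

noncomputable section

/-! ### Smooth 1-forms, closed forms, exact forms and first de Rham cohomology -/

section Forms

variable {E : Type*} [NormedAddCommGroup E] [NormedSpace ℝ E]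
  {H : Type*} [TopologicalSpace H] (I : ModelWithCorners ℝ E H)
  (N : Type*) [TopologicalSpace N] [ChartedSpace H N] [IsManifold I ∞ N]

/-- Smooth real 1-forms on `N`: smooth sections of the cotangent bundle. -/
abbrev OneForm : Type _ :=
  ContMDiffSection I (E →L[ℝ] ℝ) ∞
    (fun p : N => TangentSpace I p →L[ℝ] Bundle.Trivial N ℝ p)

variable {I N}

/-- The value of a 1-form at a point, as a linear functional on the tangent space. -/
def OneForm.val (α : OneForm I N) (p : N) : TangentSpace I p →L[ℝ] ℝ := α p

/-- The components of a 1-form in the chart around `p₀`, i.e. the pullback of `α` under the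
inverse of the (extended) chart; meaningful on `(extChartAt I p₀).target`. -/
def OneForm.chartRep (α : OneForm I N) (p₀ : N) (y : E) : E →L[ℝ] ℝ :=
  (α.val ((extChartAt I p₀).symm y)).comp
    (mfderivWithin 𝓘(ℝ, E) I (extChartAt I p₀).symm (Set.range I) y)

/-- `dα = 0`: in every chart `dα(u, v) = ∂_u (α v) - ∂_v (α u)` vanishes. -/
def OneForm.IsClosedForm (α : OneForm I N) : Prop :=
  ∀ p₀ : N, ∀ y ∈ (extChartAt I p₀).target, ∀ u v : E,
    fderivWithin ℝ (fun z => α.chartRep p₀ z v) (Set.range I) y u =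
      fderivWithin ℝ (fun z => α.chartRep p₀ z u) (Set.range I) y v

/-- The differential of a function at a point, as a linear functional. -/
def differential (I : ModelWithCorners ℝ E H) (f : N → ℝ) (p : N) : TangentSpace I p →L[ℝ] ℝ :=
  mfderiv I 𝓘(ℝ, ℝ) f p

/-- `α = df` for some smooth function `f`. -/
def OneForm.IsExactForm (α : OneForm I N) : Prop :=
  ∃ f : N → ℝ, ContMDiff I 𝓘(ℝ, ℝ) ∞ f ∧
    ∀ (p : N) (v : TangentSpace I p), α.val p v = differential I f p v

theorem OneForm.chartRep_apply_contDiffOn (α : OneForm I N) (p₀ : N) (u : E) :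
    ContDiffOn ℝ ∞ (fun y => α.chartRep p₀ y u) (extChartAt I p₀).target := by
  rw [← contMDiffOn_iff_contDiffOn]
  have h1 : ContMDiffOn 𝓘(ℝ, E) I ∞ (extChartAt I p₀).symm (extChartAt I p₀).target :=
    contMDiffOn_extChartAt_symm p₀
  have h2 : ContMDiffOn 𝓘(ℝ, E) (I.prod 𝓘(ℝ, E →L[ℝ] ℝ)) ∞
      (fun y => Bundle.TotalSpace.mk' (E →L[ℝ] ℝ)
        (E := fun p : N => TangentSpace I p →L[ℝ] Bundle.Trivial N ℝ p)
        ((extChartAt I p₀).symm y) (α ((extChartAt I p₀).symm y)))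
      (extChartAt I p₀).target := (ContMDiffSection.contMDiff α).comp_contMDiffOn h1
  have hu : UniqueMDiffOn 𝓘(ℝ, E) (extChartAt I p₀).target :=
    (uniqueDiffOn_extChartAt_target p₀).uniqueMDiffOn
  have hc : ContMDiffOn 𝓘(ℝ, E) 𝓘(ℝ, E).tangent ∞
      (fun y => (Bundle.TotalSpace.mk y u : TangentBundle 𝓘(ℝ, E) E))
      (extChartAt I p₀).target := fun y _ =>
    contMDiffWithinAt_vectorSpace_iff_contDiffWithinAt.2 contDiffWithinAt_const
  have h3 : ContMDiffOn 𝓘(ℝ, E) I.tangent ∞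
      (fun y => (Bundle.TotalSpace.mk' E ((extChartAt I p₀).symm y)
        (mfderivWithin 𝓘(ℝ, E) I (extChartAt I p₀).symm (extChartAt I p₀).target y u) :
          TangentBundle I N)) (extChartAt I p₀).target :=
    (h1.contMDiffOn_tangentMapWithin (m := ∞) le_rfl hu).comp hc (fun y hy => hy)
  have h4 := h2.clm_bundle_apply h3
  intro y hy
  have h5 := (Bundle.contMDiffWithinAt_totalSpace.1 (h4 y hy)).2
  refine h5.congr (fun z hz => ?_) ?_
  · have hz' : mfderivWithin 𝓘(ℝ, E) I (extChartAt I p₀).symm (extChartAt I p₀).target z =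
        mfderivWithin 𝓘(ℝ, E) I (extChartAt I p₀).symm (Set.range I) z :=
      mfderivWithin_subset (extChartAt_target_subset_range p₀) (hu z hz)
        (mdifferentiableWithinAt_extChartAt_symm hz)
    simp only [hz']
    rfl
  · have hz' : mfderivWithin 𝓘(ℝ, E) I (extChartAt I p₀).symm (extChartAt I p₀).target y =
        mfderivWithin 𝓘(ℝ, E) I (extChartAt I p₀).symm (Set.range I) y :=
      mfderivWithin_subset (extChartAt_target_subset_range p₀) (hu y hy)
        (mdifferentiableWithinAt_extChartAt_symm hy)
    simp only [hz']
    rfl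

theorem OneForm.chartRep_differentiableWithinAt (α : OneForm I N) (p₀ : N) (u : E) {y : E}
    (hy : y ∈ (extChartAt I p₀).target) :
    DifferentiableWithinAt ℝ (fun z => α.chartRep p₀ z u) (Set.range I) y :=
  ((α.chartRep_apply_contDiffOn p₀ u y hy).differentiableWithinAt (by simp)).mono_of_mem_nhdsWithin
    (extChartAt_target_mem_nhdsWithin_of_mem hy)

/-- Boundedness of a sequence in the Fréchet space of smooth 1-forms on a manifold without
boundary: in every chart, all derivatives of all orders of the components are bounded on compact
sets, uniformly along the sequence. -/
def IsBoundedSeq (ρ : ℕ → OneForm I N) : Prop :=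
  ∀ (p₀ : N) (K : Set E), IsCompact K → K ⊆ (extChartAt I p₀).target → ∀ r : ℕ,
    ∃ C : ℝ, ∀ j : ℕ, ∀ y ∈ K, ‖iteratedFDeriv ℝ r ((ρ j).chartRep p₀) y‖ ≤ C

variable (I N)

/-- The space of closed smooth 1-forms. -/
def closedForms : Submodule ℝ (OneForm I N) where
  carrier := {α | α.IsClosedForm}
  zero_mem' := fun p₀ y hy u v => by
    have h : ∀ w : E, (fun z => (0 : OneForm I N).chartRep p₀ z w) = fun _ => (0 : ℝ) :=
      fun w => rfl
    simp [h]
  add_mem' := fun {α β} hα hβ p₀ y hy u v => by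
    have hI : UniqueDiffWithinAt ℝ (Set.range I) y :=
      I.uniqueDiffOn y (extChartAt_target_subset_range p₀ hy)
    have h : ∀ w : E, (fun z => (α + β).chartRep p₀ z w) =
        (fun z => α.chartRep p₀ z w) + fun z => β.chartRep p₀ z w := fun w => rfl
    rw [h, h, fderivWithin_add hI (α.chartRep_differentiableWithinAt p₀ v hy)
      (β.chartRep_differentiableWithinAt p₀ v hy),
      fderivWithin_add hI (α.chartRep_differentiableWithinAt p₀ u hy)
      (β.chartRep_differentiableWithinAt p₀ u hy)]
    simp only [add_apply, hα p₀ y hy u v, hβ p₀ y hy u v]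
  smul_mem' := fun c α hα p₀ y hy u v => by
    have hI : UniqueDiffWithinAt ℝ (Set.range I) y :=
      I.uniqueDiffOn y (extChartAt_target_subset_range p₀ hy)
    have h : ∀ w : E, (fun z => (c • α).chartRep p₀ z w) =
        c • (fun z => α.chartRep p₀ z w) := fun w => rfl
    rw [h, h, fderivWithin_const_smul hI (α.chartRep_differentiableWithinAt p₀ v hy) c,
      fderivWithin_const_smul hI (α.chartRep_differentiableWithinAt p₀ u hy) c]
    simp only [smul_apply, hα p₀ y hy u v]

/-- The space of exact smooth 1-forms. -/
def exactForms : Submodule ℝ (OneForm I N) where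
  carrier := {α | α.IsExactForm}
  zero_mem' := ⟨fun _ => 0, contMDiff_const, fun p v => by
    rw [differential, mfderiv_const]; rfl⟩
  add_mem' := by
    rintro α β ⟨f, hf, hf'⟩ ⟨g, hg, hg'⟩
    refine ⟨f + g, hf.add hg, fun p v => ?_⟩
    have h := mfderiv_add (hf.mdifferentiable (by simp) p) (hg.mdifferentiable (by simp) p)
    rw [differential, h]
    exact congrArg₂ (· + ·) (hf' p v) (hg' p v)
  smul_mem' := by
    rintro c α ⟨f, hf, hf'⟩
    refine ⟨c • f,
      (contMDiff_const : ContMDiff I 𝓘(ℝ, ℝ) ∞ fun _ : N => c).smul hf, fun p v => ?_⟩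
    have h := const_smul_mfderiv (hf.mdifferentiable (by simp) p) c
    rw [differential, h]
    exact congrArg (c * ·) (hf' p v)

/-- The first de Rham cohomology `H¹(N)` : closed 1-forms modulo exact 1-forms. -/
abbrev DeRhamH1 : Type _ :=
  closedForms I N ⧸ (exactForms I N).submoduleOf (closedForms I N)

end Forms

/-! ### Smooth singular homology in degree one, integration of 1-forms over 1-chains -/

section Homology

variable {E : Type*} [NormedAddCommGroup E] [NormedSpace ℝ E]
  {H : Type*} [TopologicalSpace H] (I : ModelWithCorners ℝ E H)
  (N : Type*) [TopologicalSpace N] [ChartedSpace H N]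

/-- Smooth singular `q`-simplices in `N`: maps from the standard simplex that extend smoothly to a
neighbourhood of it (in the space of barycentric coordinates). -/
structure SmoothSimplex (q : ℕ) where
  toFun : stdSimplex ℝ (Fin (q + 1)) → N
  smooth : ∃ (U : Set (Fin (q + 1) → ℝ)) (F : (Fin (q + 1) → ℝ) → N),
    IsOpen U ∧ stdSimplex ℝ (Fin (q + 1)) ⊆ U ∧
    ContMDiffOn 𝓘(ℝ, Fin (q + 1) → ℝ) I ∞ F U ∧
    ∀ s : stdSimplex ℝ (Fin (q + 1)), F (s : Fin (q + 1) → ℝ) = toFun s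

variable {I N}

/-- The `i`-th face of a smooth singular simplex (the face opposite to the `i`-th vertex). -/
def SmoothSimplex.face {q : ℕ} (σ : SmoothSimplex I N (q + 1)) (i : Fin (q + 2)) :
    SmoothSimplex I N q where
  toFun := fun s => σ.toFun (stdSimplex.map i.succAbove s)
  smooth := by
    obtain ⟨U, F, hU, hsub, hF, hFσ⟩ := σ.smooth
    let L : (Fin (q + 1) → ℝ) →L[ℝ] (Fin (q + 2) → ℝ) :=
      LinearMap.toContinuousLinearMap (FunOnFinite.linearMap ℝ ℝ i.succAbove)
    have hL : ∀ s : stdSimplex ℝ (Fin (q + 1)),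
        L (s : Fin (q + 1) → ℝ) = (stdSimplex.map i.succAbove s : Fin (q + 2) → ℝ) :=
      fun s => rfl
    refine ⟨L ⁻¹' U, F ∘ L, hU.preimage L.continuous, fun s hs => ?_, ?_, fun s => ?_⟩
    · exact hsub (stdSimplex.map i.succAbove ⟨s, hs⟩).2
    · exact hF.comp L.contDiff.contMDiff.contMDiffOn fun s hs => hs
    · exact hFσ (stdSimplex.map i.succAbove s)

variable (I N)

/-- Smooth singular chains with integer coefficients. -/
abbrev SmoothChain (q : ℕ) : Type _ := SmoothSimplex I N q →₀ ℤ

/-- The singular boundary operator `∂ σ = ∑ (-1)^i (i-th face of σ)`. -/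
def chainBoundary (q : ℕ) : SmoothChain I N (q + 1) →ₗ[ℤ] SmoothChain I N q :=
  Finsupp.linearCombination ℤ fun σ : SmoothSimplex I N (q + 1) =>
    ∑ i : Fin (q + 2), ((-1 : ℤ) ^ (i : ℕ)) • Finsupp.single (σ.face i) (1 : ℤ)

/-- Smooth 1-cycles. -/
abbrev OneCycle : Submodule ℤ (SmoothChain I N 1) := LinearMap.ker (chainBoundary I N 0)

/-- The first (smooth singular) homology group `H₁(N; ℤ)`. -/
abbrev SingularH1 : Type _ :=
  OneCycle I N ⧸ (LinearMap.range (chainBoundary I N 1)).submoduleOf (OneCycle I N)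

/-- The free part `H₁(N; ℤ) / torsion`. -/
abbrev FreeH1 : Type _ := SingularH1 I N ⧸ Submodule.torsion ℤ (SingularH1 I N)

variable {I N}

/-- The class of a 1-cycle in the free part of `H₁(N; ℤ)`. -/
def freeClass (z : OneCycle I N) : FreeH1 I N :=
  Submodule.Quotient.mk (Submodule.Quotient.mk z)

/-- The path `[0, 1] → N`, `t ↦ σ (1 - t, t)`, of a smooth 1-simplex (constant outside of
`[0, 1]`). -/
def SmoothSimplex.path (σ : SmoothSimplex I N 1) (t : ℝ) : N :=
  σ.toFun ((stdSimplexHomeomorphUnitInterval).symm (Set.projIcc 0 1 zero_le_one t))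

variable [IsManifold I ∞ N]

/-- The integral of a 1-form over a smooth 1-simplex. -/
def SmoothSimplex.integral (σ : SmoothSimplex I N 1) (α : OneForm I N) : ℝ :=
  ∫ t in (0 : ℝ)..1,
    α.val (σ.path t) (mfderivWithin 𝓘(ℝ, ℝ) I σ.path (Set.Icc 0 1) t (1 : ℝ))

/-- The integral of a 1-form over a smooth 1-chain. -/
def chainIntegral (c : SmoothChain I N 1) (α : OneForm I N) : ℝ :=
  c.sum fun σ k => (k : ℝ) * σ.integral α

end Homology

/-- The Euclidean norm on `ℝ^ι`. -/
def euclNorm {ι : Type*} [Fintype ι] (v : ι → ℝ) : ℝ := ‖WithLp.toLp 2 v‖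

/-- The Diophantine condition for a real `d × m` matrix. -/
def SatisfiesDC {m d : ℕ} (A : Matrix (Fin d) (Fin m) ℝ) : Prop :=
  ∃ C > (0 : ℝ), ∃ ρ > (0 : ℝ), ∀ (ξ : Fin m → ℤ) (η : Fin d → ℤ), (ξ, η) ≠ 0 →
    C * (euclNorm (fun ℓ => (η ℓ : ℝ)) + euclNorm (fun k => (ξ k : ℝ))) ^ (-ρ) ≤
      euclNorm ((fun ℓ => (η ℓ : ℝ)) + A.mulVec (fun k => (ξ k : ℝ)))

/-! ### Asymptotically Euclidean (scattering) manifolds -/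

/-- An asymptotically Euclidean manifold of dimension `n + 1`: `Mbar` is a smooth manifold with
boundary (its compactness is a hypothesis where the structure is used), `M` is its interior and
`bM` its boundary, and `M` carries a Riemannian metric which near the boundary has the form
`dx² / x⁴ + g' / x²`, with `x` a boundary defining function and `g'` a smooth symmetric 2-tensor on
`Mbar` that restricts to a metric on the boundary. -/
structure ScatteringManifold (n : ℕ) (Mbar M bM : Type*)
    [TopologicalSpace Mbar] [ChartedSpace (EuclideanHalfSpace (n + 1)) Mbar]
    [IsManifold (𝓡∂ (n + 1)) ∞ Mbar]
    [TopologicalSpace M] [ChartedSpace (EuclideanSpace ℝ (Fin (n + 1))) M]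
    [IsManifold (𝓡 (n + 1)) ∞ M]
    [TopologicalSpace bM] [ChartedSpace (EuclideanSpace ℝ (Fin n)) bM]
    [IsManifold (𝓡 n) ∞ bM] where
  /-- the inclusion of the interior, a diffeomorphism onto the interior of `Mbar` -/
  incl : M → Mbar
  incl_isLocalDiffeomorph : IsLocalDiffeomorph (𝓡 (n + 1)) (𝓡∂ (n + 1)) ∞ incl
  incl_injective : Function.Injective incl
  range_incl : Set.range incl = (𝓡∂ (n + 1)).interior Mbar
  /-- the inclusion of the boundary -/
  bincl : bM → Mbar
  bincl_isSmoothEmbedding : Manifold.IsSmoothEmbedding (𝓡 n) (𝓡∂ (n + 1)) ∞ bincl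
  range_bincl : Set.range bincl = (𝓡∂ (n + 1)).boundary Mbar
  /-- the boundary defining function `x` -/
  bdf : Mbar → ℝ
  bdf_smooth : ContMDiff (𝓡∂ (n + 1)) 𝓘(ℝ, ℝ) ∞ bdf
  bdf_nonneg : ∀ p, 0 ≤ bdf p
  bdf_eq_zero_iff : ∀ p, bdf p = 0 ↔ p ∈ (𝓡∂ (n + 1)).boundary Mbar
  mfderiv_bdf_ne_zero : ∀ p ∈ (𝓡∂ (n + 1)).boundary Mbar,
    mfderiv (𝓡∂ (n + 1)) 𝓘(ℝ, ℝ) bdf p ≠ 0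
  /-- the Riemannian metric `g` on the interior -/
  metric : Bundle.ContMDiffRiemannianMetric (𝓡 (n + 1)) ∞ (EuclideanSpace ℝ (Fin (n + 1)))
    (fun p : M => TangentSpace (𝓡 (n + 1)) p)
  /-- the tensor `g'` -/
  tensor : ∀ p : Mbar,
    TangentSpace (𝓡∂ (n + 1)) p →L[ℝ] TangentSpace (𝓡∂ (n + 1)) p →L[ℝ] ℝ
  tensor_smooth : ContMDiff (𝓡∂ (n + 1))
    ((𝓡∂ (n + 1)).prod 𝓘(ℝ, EuclideanSpace ℝ (Fin (n + 1)) →L[ℝ]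
      EuclideanSpace ℝ (Fin (n + 1)) →L[ℝ] ℝ)) ∞
    (fun p : Mbar => Bundle.TotalSpace.mk' (EuclideanSpace ℝ (Fin (n + 1)) →L[ℝ]
      EuclideanSpace ℝ (Fin (n + 1)) →L[ℝ] ℝ)
      (E := fun p : Mbar => TangentSpace (𝓡∂ (n + 1)) p →L[ℝ]
        TangentSpace (𝓡∂ (n + 1)) p →L[ℝ] Bundle.Trivial Mbar ℝ p) p (tensor p))
  tensor_symm : ∀ (p : Mbar) (v w : TangentSpace (𝓡∂ (n + 1)) p), tensor p v w = tensor p w v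
  tensor_pos_boundary : ∀ (q : bM) (v : TangentSpace (𝓡 n) q), v ≠ 0 →
    0 < tensor (bincl q) (mfderiv (𝓡 n) (𝓡∂ (n + 1)) bincl q v)
      (mfderiv (𝓡 n) (𝓡∂ (n + 1)) bincl q v)
  metric_near_boundary : ∃ U : Set Mbar, IsOpen U ∧ (𝓡∂ (n + 1)).boundary Mbar ⊆ U ∧
    ∀ p : M, incl p ∈ U → ∀ v w : TangentSpace (𝓡 (n + 1)) p,
      metric.inner p v w =
        differential (𝓡 (n + 1)) (bdf ∘ incl) p v *
          differential (𝓡 (n + 1)) (bdf ∘ incl) p w / bdf (incl p) ^ 4 +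
          tensor (incl p) (mfderiv (𝓡 (n + 1)) (𝓡∂ (n + 1)) incl p v)
            (mfderiv (𝓡 (n + 1)) (𝓡∂ (n + 1)) incl p w) / bdf (incl p) ^ 2

namespace ScatteringManifold

variable {n : ℕ} {Mbar M bM : Type*}
  [TopologicalSpace Mbar] [ChartedSpace (EuclideanHalfSpace (n + 1)) Mbar]
  [IsManifold (𝓡∂ (n + 1)) ∞ Mbar]
  [TopologicalSpace M] [ChartedSpace (EuclideanSpace ℝ (Fin (n + 1))) M]
  [IsManifold (𝓡 (n + 1)) ∞ M]
  [TopologicalSpace bM] [ChartedSpace (EuclideanSpace ℝ (Fin n)) bM]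
  [IsManifold (𝓡 n) ∞ bM]
  (S : ScatteringManifold n Mbar M bM)

/-- `(β, θ)` is a cocycle of degree one of the relative de Rham complex of `(Mbar, ∂M)`, whose
differential is `d(β, θ) = (dβ, i^*β - dθ)`; here `θ` is a smooth function on the boundary. -/
def IsRelCocycle (β : OneForm (𝓡∂ (n + 1)) Mbar) (θ : bM → ℝ) : Prop :=
  β.IsClosedForm ∧ ContMDiff (𝓡 n) 𝓘(ℝ, ℝ) ∞ θ ∧
    ∀ (q : bM) (v : TangentSpace (𝓡 n) q),
      β.val (S.bincl q) (mfderiv (𝓡 n) (𝓡∂ (n + 1)) S.bincl q v) =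
        differential (𝓡 n) θ q v

/-- `α` is the restriction of `β` to the interior `M`. -/
def IsRestriction (β : OneForm (𝓡∂ (n + 1)) Mbar) (α : OneForm (𝓡 (n + 1)) M) : Prop :=
  ∀ (p : M) (v : TangentSpace (𝓡 (n + 1)) p),
    α.val p v = β.val (S.incl p) (mfderiv (𝓡 (n + 1)) (𝓡∂ (n + 1)) S.incl p v)

/-- The closed 1-forms on `M` that are restrictions of forms `β` smooth up to the boundary which
represent a class in the image of `H¹(Mbar, ∂M) → H¹(Mbar)`, `[(β, θ)] ↦ [β]`. -/
def relRepresentatives : Submodule ℝ (closedForms (𝓡 (n + 1)) M) where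
  carrier := {α | ∃ β θ, S.IsRelCocycle β θ ∧ S.IsRestriction β α.1}
  zero_mem' := by
    refine ⟨0, fun _ => 0, ⟨(closedForms _ _).zero_mem, contMDiff_const, fun q v => ?_⟩,
      fun p v => rfl⟩
    rw [differential, mfderiv_const]
    rfl
  add_mem' := by
    rintro α α' ⟨β, θ, ⟨h1, h2, h3⟩, h4⟩ ⟨β', θ', ⟨h1', h2', h3'⟩, h4'⟩
    refine ⟨β + β', θ + θ', ⟨(closedForms _ _).add_mem h1 h1', h2.add h2', fun q v => ?_⟩,
      fun p v => congrArg₂ (· + ·) (h4 p v) (h4' p v)⟩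
    have h := mfderiv_add (h2.mdifferentiable (by simp) q) (h2'.mdifferentiable (by simp) q)
    rw [differential, h]
    exact congrArg₂ (· + ·) (h3 q v) (h3' q v)
  smul_mem' := by
    rintro c α ⟨β, θ, ⟨h1, h2, h3⟩, h4⟩
    refine ⟨c • β, c • θ, ⟨(closedForms _ _).smul_mem c h1,
      (contMDiff_const : ContMDiff (𝓡 n) 𝓘(ℝ, ℝ) ∞ fun _ : bM => c).smul h2, fun q v => ?_⟩,
      fun p v => congrArg (c * ·) (h4 p v)⟩
    have h := const_smul_mfderiv (h2.mdifferentiable (by simp) q) c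
    rw [differential, h]
    exact congrArg (c * ·) (h3 q v)

/-- `H¹_{∂M}(M)` : the image of `H¹(Mbar, ∂M) → H¹(Mbar)`, regarded as a subspace of `H¹(M)` by
restriction to the interior. -/
def boundaryH1 : Submodule ℝ (DeRhamH1 (𝓡 (n + 1)) M) :=
  S.relRepresentatives.map (Submodule.mkQ _)

/-- The closed smooth 1-forms on `M` whose cohomology class lies in `H¹_{∂M}(M)`. -/
def boundaryForms : Submodule ℝ (OneForm (𝓡 (n + 1)) M) :=
  (S.boundaryH1.comap (Submodule.mkQ _)).map (closedForms (𝓡 (n + 1)) M).subtype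

/-- Integral 1-forms: all integrals over smooth 1-cycles lie in `2πℤ`. -/
def IsIntegral (α : OneForm (𝓡 (n + 1)) M) : Prop :=
  α ∈ S.boundaryForms ∧
    ∀ z : OneCycle (𝓡 (n + 1)) M, ∃ k : ℤ, chainIntegral z.1 α = 2 * Real.pi * k

/-- The 1-form `ξ · om = ∑ ξ_k om_k`. -/
def combo {m : ℕ} (ξ : Fin m → ℤ) (om : Fin m → OneForm (𝓡 (n + 1)) M) :
    OneForm (𝓡 (n + 1)) M :=
  ∑ k, (ξ k : ℝ) • om k

/-- The family `om` is rational. -/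
def IsRational {m : ℕ} (om : Fin m → OneForm (𝓡 (n + 1)) M) : Prop :=
  ∃ ξ : Fin m → ℤ, ξ ≠ 0 ∧ S.IsIntegral (combo ξ om)

/-- The family `om` is Liouville. -/
def IsLiouville {m : ℕ} (om : Fin m → OneForm (𝓡 (n + 1)) M) : Prop :=
  ¬ S.IsRational om ∧
    ∃ (θ : ℕ → OneForm (𝓡 (n + 1)) M) (ξ : ℕ → Fin m → ℤ),
      (∀ j, S.IsIntegral (θ j)) ∧
      Filter.Tendsto (fun j => euclNorm fun k => (ξ j k : ℝ)) Filter.atTop Filter.atTop ∧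
      IsBoundedSeq fun j => (euclNorm fun k => (ξ j k : ℝ)) ^ j • (combo (ξ j) om - θ j)

/-- The cycles `σ₁, …, σ_{d'}` (`d' = d + e`) used to form the matrix of periods: their classes are
a `ℤ`-basis of the free part of `H₁(M; ℤ)`, where `d = dim H¹_{∂M}(M)`, and all 1-forms with class
in `H¹_{∂M}(M)` have zero integral over the last `e` of them. Equivalently, up to the factor `2π`,
they are dual to a basis of `H¹(M)` whose first `d` members form a basis of `H¹_{∂M}(M)`. -/
structure IsAdapted {d e : ℕ} (σ : Fin (d + e) → OneCycle (𝓡 (n + 1)) M) : Prop where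
  linearIndependent : LinearIndependent ℤ fun ℓ => freeClass (σ ℓ)
  span_eq_top : Submodule.span ℤ (Set.range fun ℓ => freeClass (σ ℓ)) = ⊤
  finrank_eq : Module.finrank ℝ S.boundaryH1 = d
  integral_eq_zero : ∀ α ∈ S.boundaryForms, ∀ ℓ : Fin e,
    chainIntegral (σ (Fin.natAdd d ℓ)).1 α = 0

/-- The matrix of periods `A(om)_{ℓ k} = (1 / 2π) ∫_{σ_ℓ} om_k`, `1 ≤ ℓ ≤ d`, `1 ≤ k ≤ m`. -/
def periodMatrix {d e m : ℕ} (σ : Fin (d + e) → OneCycle (𝓡 (n + 1)) M)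
    (om : Fin m → OneForm (𝓡 (n + 1)) M) : Matrix (Fin d) (Fin m) ℝ :=
  Matrix.of fun ℓ k => 1 / (2 * Real.pi) * chainIntegral (σ (Fin.castAdd e ℓ)).1 (om k)

end ScatteringManifold

end

/-!
Both equivalences reduce to linear algebra once closed 1-forms with class in `H¹_{∂M}(M)` are
described by their periods over the first `d` cycles.

By Stokes' theorem (`OneForm.IsClosedForm.chainIntegral_chainBoundary`) the integral of such a form
over any cycle is an integer combination of its `d` periods, so the form is integral exactly when
its normalized periods are integers; the periods of `ξ · ω` are `A(ω) ξ`, which gives the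
characterization of rationality. Conversely a closed form whose integrals over all cycles vanish
is exact (`OneForm.IsClosedForm.isExactForm_of_chainIntegral_eq_zero`), so the period map is
injective on `H¹_{∂M}(M)`, hence bijective onto `ℝ^d` since the dimensions agree
(`ScatteringManifold.IsAdapted.exists_periodMap_eq`); de Rham's theorem is not needed. In
particular there are forms `φ_ℓ` with unit periods.

If `A = A(ω)` has no resonances and violates (DC), there are `ξ_j → ∞` and `η_j` with
`|ξ_j|^j |η_j + A ξ_j| ≤ 1` (`exists_seq_of_not_satisfiesDC`). The forms
`θ_j = ξ_j · ω - ∑ (η_j + A ξ_j)_ℓ φ_ℓ` have periods `-η_j`, and `|ξ_j|^j (ξ_j · ω - θ_j)` is a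
combination of the fixed forms `φ_ℓ` with bounded coefficients. In the other direction, integration
over a fixed cycle is bounded on bounded sequences of forms
(`IsBoundedSeq.exists_abs_chainIntegral_le`), so a Liouville approximation bounds
`|ξ_j|^j |η_j + A ξ_j|`, which is incompatible with (DC) (`SatisfiesDC.not_superpolynomial`).

Stokes' theorem, the exactness criterion and the integrability of the integrands all rest on
Poincaré's lemma for convex sets, applied in chart balls and, after pulling back, to a convex
neighbourhood of the standard simplex.
-/

noncomputable section

/-! ### Local primitives of closed 1-forms -/

section LocalPrimitives

variable {E : Type*} [NormedAddCommGroup E] [NormedSpace ℝ E]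
  {H : Type*} [TopologicalSpace H] {I : ModelWithCorners ℝ E H}
  {N : Type*} [TopologicalSpace N] [ChartedSpace H N] [IsManifold I ∞ N]

/-- `f` is a smooth primitive of `α` on `W`: it is smooth on `W` and `df = α` there. -/
def OneForm.IsPrimitiveOn (α : OneForm I N) (f : N → ℝ) (W : Set N) : Prop :=
  ContMDiffOn I 𝓘(ℝ, ℝ) ∞ f W ∧ ∀ p ∈ W, HasMFDerivAt I 𝓘(ℝ, ℝ) f p (α.val p)

theorem OneForm.isExactForm_iff_exists_isPrimitiveOn {α : OneForm I N} :
    α.IsExactForm ↔ ∃ f, α.IsPrimitiveOn f Set.univ := by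
  constructor
  · rintro ⟨f, hf, h⟩
    refine ⟨f, hf.contMDiffOn, fun p _ => ?_⟩
    have h1 := (hf.mdifferentiable (by simp) p).hasMFDerivAt
    have h2 : α.val p = mfderiv I 𝓘(ℝ, ℝ) f p := ContinuousLinearMap.ext (h p)
    rw [h2]
    exact h1
  · rintro ⟨f, hf, h⟩
    refine ⟨f, contMDiffOn_univ.1 hf, fun p v => ?_⟩
    rw [differential, (h p trivial).mfderiv]

theorem OneForm.chartRep_extChartAt_apply (α : OneForm I N) {p₀ p : N}
    (hp : p ∈ (extChartAt I p₀).source) (v : TangentSpace I p) :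
    α.chartRep p₀ (extChartAt I p₀ p) (mfderiv I 𝓘(ℝ, E) (extChartAt I p₀) p v) = α.val p v := by
  have h := congrArg (fun L => L v)
    (mfderivWithin_extChartAt_symm_comp_mfderiv_extChartAt' (I := I) hp)
  have h2 := (extChartAt I p₀).left_inv hp
  simp only [OneForm.chartRep]
  change α.val ((extChartAt I p₀).symm (extChartAt I p₀ p)) _ = _
  -- the base points agree only propositionally, so the values are compared on the model space
  have h3 : ∀ q : N, q = p → ∀ w : E, w = v → (α.val q : E →L[ℝ] ℝ) w = (α.val p : E →L[ℝ] ℝ) v := by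
    rintro q rfl w rfl; rfl
  exact h3 _ h2 _ h

variable [FiniteDimensional ℝ E]

theorem OneForm.chartRep_contDiffOn (α : OneForm I N) (p₀ : N) :
    ContDiffOn ℝ ∞ (α.chartRep p₀) (extChartAt I p₀).target :=
  contDiffOn_clm_apply.2 fun u => α.chartRep_apply_contDiffOn p₀ u

variable [I.Boundaryless]

/-- Poincaré's lemma in a chart: a closed form has a primitive on every chart ball. -/
theorem OneForm.IsClosedForm.exists_isPrimitiveOn_ball {α : OneForm I N} (hα : α.IsClosedForm)
    (p₀ : N) {y : E} {r : ℝ} (hr : Metric.ball y r ⊆ (extChartAt I p₀).target) :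
    ∃ f, α.IsPrimitiveOn f
      ((extChartAt I p₀).source ∩ extChartAt I p₀ ⁻¹' Metric.ball y r) := by
  have hsm := (α.chartRep_contDiffOn p₀).mono hr
  have hdiff : DifferentiableOn ℝ (α.chartRep p₀) (Metric.ball y r) :=
    hsm.differentiableOn (by simp)
  have happ : ∀ a ∈ Metric.ball y r, ∀ u v : E,
      fderiv ℝ (α.chartRep p₀) a u v = fderiv ℝ (fun z => α.chartRep p₀ z v) a u := by
    intro a ha u v
    have hd := hdiff.differentiableAt (Metric.isOpen_ball.mem_nhds ha)
    have := (hd.hasFDerivAt.clm_apply (hasFDerivAt_const v a)).fderiv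
    rw [this]
    simp
  obtain ⟨g, hg⟩ := (convex_ball y r).exists_forall_hasFDerivAt_of_fderiv_symmetric
    Metric.isOpen_ball hdiff (fun a ha u v => by
      have := hα p₀ a (hr ha) u v
      simp only [ModelWithCorners.Boundaryless.range_eq_univ, fderivWithin_univ] at this
      rw [happ a ha, happ a ha, this])
  have hgs : ContDiffOn ℝ ∞ g (Metric.ball y r) := by
    rw [contDiffOn_infty_iff_fderiv_of_isOpen Metric.isOpen_ball]
    exact ⟨fun a ha => (hg a ha).differentiableAt.differentiableWithinAt,
      hsm.congr fun a ha => (hg a ha).fderiv⟩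
  refine ⟨g ∘ extChartAt I p₀, ?_, ?_⟩
  · refine hgs.contMDiffOn.comp (t := Metric.ball y r) ?_ fun p hp => hp.2
    exact (contMDiffOn_extChartAt (I := I) (n := ∞)).mono fun p hp => by
      simpa [extChartAt_source] using hp.1
  · rintro p ⟨hp, hpb⟩
    have h1 : HasMFDerivAt 𝓘(ℝ, E) 𝓘(ℝ, ℝ) g (extChartAt I p₀ p)
      (α.chartRep p₀ (extChartAt I p₀ p)) := (hg _ hpb).hasMFDerivAt
    have h2 : HasMFDerivAt I 𝓘(ℝ, E) (extChartAt I p₀) p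
        (mfderiv I 𝓘(ℝ, E) (extChartAt I p₀) p) :=
      (mdifferentiableAt_extChartAt (by simpa [extChartAt_source] using hp)).hasMFDerivAt
    have h3 := h1.comp p h2
    have h4 : α.val p = (α.chartRep p₀ (extChartAt I p₀ p)).comp
        (mfderiv I 𝓘(ℝ, E) (extChartAt I p₀) p) :=
      ContinuousLinearMap.ext fun v => (α.chartRep_extChartAt_apply hp v).symm
    rw [h4]
    exact h3

theorem OneForm.IsClosedForm.exists_isPrimitiveOn {α : OneForm I N} (hα : α.IsClosedForm)
    (p₀ : N) : ∃ W f, IsOpen W ∧ p₀ ∈ W ∧ α.IsPrimitiveOn f W := by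
  obtain ⟨r, hr, hsub⟩ := Metric.isOpen_iff.1 (isOpen_extChartAt_target (I := I) p₀) _
    (mem_extChartAt_target p₀)
  obtain ⟨f, hf⟩ := hα.exists_isPrimitiveOn_ball p₀ hsub
  exact ⟨_, f, isOpen_extChartAt_preimage' p₀ Metric.isOpen_ball,
    ⟨mem_extChartAt_source p₀, Metric.mem_ball_self hr⟩, hf⟩

end LocalPrimitives

/-! ### Pullbacks of closed 1-forms to vector spaces -/

section Pullback

variable {E : Type*} [NormedAddCommGroup E] [NormedSpace ℝ E]
  {H : Type*} [TopologicalSpace H] {I : ModelWithCorners ℝ E H}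
  {N : Type*} [TopologicalSpace N] [ChartedSpace H N] [IsManifold I ∞ N]
  {G : Type*} [NormedAddCommGroup G] [NormedSpace ℝ G]

/-- The pullback of a 1-form on a manifold under a map from a vector space. -/
def OneForm.pullback (α : OneForm I N) (F : G → N) (y : G) : G →L[ℝ] ℝ :=
  (α.val (F y)).comp (mfderiv 𝓘(ℝ, G) I F y)

theorem OneForm.IsPrimitiveOn.hasFDerivAt_comp {α : OneForm I N} {f : N → ℝ} {W : Set N}
    (hf : α.IsPrimitiveOn f W) {F : G → N} {y : G} (hF : MDifferentiableAt 𝓘(ℝ, G) I F y)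
    (hy : F y ∈ W) : HasFDerivAt (f ∘ F) (α.pullback F y) y :=
  hasMFDerivAt_iff_hasFDerivAt.1 ((hf.2 _ hy).comp y hF.hasMFDerivAt)

theorem OneForm.pullback_comp_continuousLinearMap {G' : Type*} [NormedAddCommGroup G']
    [NormedSpace ℝ G'] (α : OneForm I N) {F : G → N} (L : G' →L[ℝ] G) {y : G'}
    (hF : MDifferentiableAt 𝓘(ℝ, G) I F (L y)) :
    α.pullback (F ∘ L) y = (α.pullback F (L y)).comp L := by
  have h := (hF.hasMFDerivAt.comp y L.hasFDerivAt.hasMFDerivAt).mfderiv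
  simp only [OneForm.pullback]
  rw [h]
  rfl

variable [FiniteDimensional ℝ E] [I.Boundaryless]

/-- The pullback of a closed form to a convex open set of a vector space is exact: near each point
it is the differential of `f ∘ F` for a local primitive `f`, hence it is smooth and closed. -/
theorem OneForm.IsClosedForm.exists_hasFDerivAt_pullback {α : OneForm I N} (hα : α.IsClosedForm)
    {V : Set G} (hV : IsOpen V) (hVc : Convex ℝ V) {F : G → N}
    (hF : ContMDiffOn 𝓘(ℝ, G) I ∞ F V) :
    ∃ h : G → ℝ, ContDiffOn ℝ ∞ h V ∧ ∀ y ∈ V, HasFDerivAt h (α.pullback F y) y := by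
  have key : ∀ y ∈ V, ∃ k : G → ℝ, ContDiffAt ℝ ∞ k y ∧ α.pullback F =ᶠ[nhds y] fderiv ℝ k := by
    intro y hy
    obtain ⟨W, f, hW, hyW, hf⟩ := hα.exists_isPrimitiveOn (F y)
    have hO : IsOpen (V ∩ F ⁻¹' W) := hF.continuousOn.isOpen_inter_preimage hV hW
    refine ⟨f ∘ F, ?_, ?_⟩
    · have : ContMDiffOn 𝓘(ℝ, G) 𝓘(ℝ, ℝ) ∞ (f ∘ F) (V ∩ F ⁻¹' W) :=
        hf.1.comp (hF.mono Set.inter_subset_left) fun z hz => hz.2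
      exact (contMDiffOn_iff_contDiffOn.1 this).contDiffAt (hO.mem_nhds ⟨hy, hyW⟩)
    · filter_upwards [hO.mem_nhds ⟨hy, hyW⟩] with z hz
      exact (hf.hasFDerivAt_comp ((hF.contMDiffAt (hV.mem_nhds hz.1)).mdifferentiableAt (by simp))
        hz.2).fderiv.symm
  have hsm : ContDiffOn ℝ ∞ (α.pullback F) V := by
    intro y hy
    obtain ⟨k, hk, hkF⟩ := key y hy
    exact ((hk.fderiv_right (m := ∞) (by simp)).congr_of_eventuallyEq hkF).contDiffWithinAt
  obtain ⟨h, hh⟩ := hVc.exists_forall_hasFDerivAt_of_fderiv_symmetric hV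
    (hsm.differentiableOn (by simp)) (fun y hy u v => by
      obtain ⟨k, hk, hkF⟩ := key y hy
      rw [hkF.fderiv_eq]
      exact hk.isSymmSndFDerivAt (by simpa using ENat.LEInfty.out) u v)
  refine ⟨h, ?_, hh⟩
  rw [contDiffOn_infty_iff_fderiv_of_isOpen hV]
  exact ⟨fun a ha => (hh a ha).differentiableAt.differentiableWithinAt,
      hsm.congr fun a ha => (hh a ha).fderiv⟩

end Pullback

/-! ### Integrals of 1-forms over smooth simplices -/

section Simplices

variable {E : Type*} [NormedAddCommGroup E] [NormedSpace ℝ E]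
  {H : Type*} [TopologicalSpace H] {I : ModelWithCorners ℝ E H}
  {N : Type*} [TopologicalSpace N] [ChartedSpace H N]

/-- The affine parametrization `t ↦ (1 - t, t)` of the line through the standard 1-simplex. -/
def stdSegment (t : ℝ) : Fin 2 → ℝ := ![1 - t, t]

theorem hasDerivAt_stdSegment (t : ℝ) : HasDerivAt stdSegment ![-1, 1] t := by
  rw [hasDerivAt_pi]
  intro i
  fin_cases i
  · simpa [stdSegment] using (hasDerivAt_id t).const_sub 1
  · exact hasDerivAt_id' t

theorem continuous_stdSegment : Continuous stdSegment :=
  continuous_iff_continuousAt.2 fun t => (hasDerivAt_stdSegment t).continuousAt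

theorem stdSegment_mem {t : ℝ} (ht : t ∈ Set.Icc (0 : ℝ) 1) :
    stdSegment t ∈ stdSimplex ℝ (Fin 2) :=
  ((stdSimplexHomeomorphUnitInterval).symm ⟨t, ht⟩).2

theorem stdSegment_zero : stdSegment 0 = Pi.single 0 1 := by
  ext i; fin_cases i <;> simp [stdSegment]

theorem stdSegment_one : stdSegment 1 = Pi.single 1 1 := by
  ext i; fin_cases i <;> simp [stdSegment]

theorem SmoothSimplex.path_eq (σ : SmoothSimplex I N 1) {F : (Fin 2 → ℝ) → N}
    (hF : ∀ s : stdSimplex ℝ (Fin 2), F (s : Fin 2 → ℝ) = σ.toFun s) {t : ℝ}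
    (ht : t ∈ Set.Icc (0 : ℝ) 1) : σ.path t = F (stdSegment t) := by
  rw [SmoothSimplex.path, ← hF, Set.projIcc_of_mem zero_le_one ht]
  rfl

variable [IsManifold I ∞ N]

/-- The integrand of `SmoothSimplex.integral` is the pullback under any smooth extension of the simplex,
evaluated at the direction of the standard 1-simplex. -/
theorem SmoothSimplex.integrand_eq (σ : SmoothSimplex I N 1) (α : OneForm I N)
    {U : Set (Fin 2 → ℝ)} {F : (Fin 2 → ℝ) → N} (hU : IsOpen U)
    (hsub : stdSimplex ℝ (Fin 2) ⊆ U) (hFU : ContMDiffOn 𝓘(ℝ, Fin 2 → ℝ) I ∞ F U)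
    (hF : ∀ s : stdSimplex ℝ (Fin 2), F (s : Fin 2 → ℝ) = σ.toFun s) {t : ℝ}
    (ht : t ∈ Set.Icc (0 : ℝ) 1) :
    α.val (σ.path t) (mfderivWithin 𝓘(ℝ, ℝ) I σ.path (Set.Icc 0 1) t (1 : ℝ)) =
      α.pullback F (stdSegment t) ![-1, 1] := by
  have hd : MDifferentiableAt 𝓘(ℝ, Fin 2 → ℝ) I F (stdSegment t) :=
    (hFU.contMDiffAt (hU.mem_nhds (hsub (stdSegment_mem ht)))).mdifferentiableAt (by simp)
  have h1 := hd.hasMFDerivAt.comp t (hasDerivAt_stdSegment t).hasFDerivAt.hasMFDerivAt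
  have h2 := (h1.hasMFDerivWithinAt (s := Set.Icc (0 : ℝ) 1)).congr_mono
    (fun s hs => σ.path_eq hF hs) (σ.path_eq hF ht) le_rfl
  have h3 := h2.mfderivWithin (uniqueDiffOn_Icc_zero_one t ht).uniqueMDiffWithinAt
  have h4 : ∀ q : N, F (stdSegment t) = q → ∀ w w' : E, w = w' →
      (α.val q : E →L[ℝ] ℝ) w = (α.val (F (stdSegment t)) : E →L[ℝ] ℝ) w' := by
    rintro q rfl w w' rfl; rfl
  refine h4 _ (σ.path_eq hF ht).symm _
    (mfderiv 𝓘(ℝ, Fin 2 → ℝ) I F (stdSegment t) ![-1, 1]) ?_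
  have h5 := congrArg (fun L => L (1 : ℝ)) h3
  refine Eq.trans h5 ?_
  exact congrArg (fun w : Fin 2 → ℝ => mfderiv 𝓘(ℝ, Fin 2 → ℝ) I F (stdSegment t) w)
    (one_smul ℝ (![-1, 1] : Fin 2 → ℝ))

/-- `h` is a primitive of the pullback of `α` to a neighbourhood of the standard simplex under some
smooth extension of `σ`. -/
def SmoothSimplex.IsPrimitive {q : ℕ} (σ : SmoothSimplex I N q) (α : OneForm I N)
    (h : (Fin (q + 1) → ℝ) → ℝ) : Prop :=
  ∃ (U : Set (Fin (q + 1) → ℝ)) (F : (Fin (q + 1) → ℝ) → N),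
    IsOpen U ∧ stdSimplex ℝ (Fin (q + 1)) ⊆ U ∧
    ContMDiffOn 𝓘(ℝ, Fin (q + 1) → ℝ) I ∞ F U ∧
    (∀ s : stdSimplex ℝ (Fin (q + 1)), F (s : Fin (q + 1) → ℝ) = σ.toFun s) ∧
    ContDiffOn ℝ ∞ h U ∧ ∀ y ∈ U, HasFDerivAt h (α.pullback F y) y

theorem SmoothSimplex.exists_isPrimitive [FiniteDimensional ℝ E] [I.Boundaryless] {q : ℕ}
    (σ : SmoothSimplex I N q) {α : OneForm I N} (hα : α.IsClosedForm) :
    ∃ h, σ.IsPrimitive α h := by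
  obtain ⟨U, F, hU, hsub, hF, hFσ⟩ := σ.smooth
  obtain ⟨δ, hδ, hδU⟩ := (isCompact_stdSimplex ℝ (Fin (q + 1))).exists_thickening_subset_open hU hsub
  obtain ⟨h, hh, hh'⟩ := hα.exists_hasFDerivAt_pullback Metric.isOpen_thickening
    ((convex_stdSimplex ℝ (Fin (q + 1))).thickening δ) (hF.mono hδU)
  exact ⟨h, _, F, Metric.isOpen_thickening, Metric.self_subset_thickening hδ _, hF.mono hδU, hFσ,
    hh, hh'⟩

/-- The linear map of barycentric coordinates that embeds a standard simplex as the `i`-th face. -/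
def faceMap {q : ℕ} (i : Fin (q + 2)) : (Fin (q + 1) → ℝ) →L[ℝ] (Fin (q + 2) → ℝ) :=
  LinearMap.toContinuousLinearMap (FunOnFinite.linearMap ℝ ℝ i.succAbove)

theorem faceMap_single {q : ℕ} (i : Fin (q + 2)) (j : Fin (q + 1)) :
    faceMap i (Pi.single j 1) = Pi.single (i.succAbove j) 1 :=
  congrArg Subtype.val (stdSimplex.map_vertex (S := ℝ) i.succAbove j)

theorem SmoothSimplex.IsPrimitive.face {q : ℕ} {σ : SmoothSimplex I N (q + 1)} {α : OneForm I N}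
    {h : (Fin (q + 2) → ℝ) → ℝ} (hh : σ.IsPrimitive α h) (i : Fin (q + 2)) :
    (σ.face i).IsPrimitive α (h ∘ faceMap i) := by
  obtain ⟨U, F, hU, hsub, hF, hFσ, hsm, hd⟩ := hh
  refine ⟨faceMap i ⁻¹' U, F ∘ faceMap i, hU.preimage (faceMap i).continuous, fun s hs => ?_,
    hF.comp (faceMap i).contDiff.contMDiff.contMDiffOn fun s hs => hs,
    fun s => hFσ (stdSimplex.map i.succAbove s),
    hsm.comp (faceMap i).contDiff.contDiffOn fun s hs => hs, fun y hy => ?_⟩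
  · exact hsub (stdSimplex.map i.succAbove ⟨s, hs⟩).2
  · rw [α.pullback_comp_continuousLinearMap (faceMap i)
      ((hF.contMDiffAt (hU.mem_nhds hy)).mdifferentiableAt (by simp))]
    exact (hd _ hy).comp y (faceMap i).hasFDerivAt

theorem SmoothSimplex.IsPrimitive.hasDerivAt_comp_stdSegment {σ : SmoothSimplex I N 1}
    {α : OneForm I N} {h : (Fin 2 → ℝ) → ℝ} (hh : σ.IsPrimitive α h) :
    ContinuousOn (fun t => α.val (σ.path t)
      (mfderivWithin 𝓘(ℝ, ℝ) I σ.path (Set.Icc 0 1) t (1 : ℝ))) (Set.Icc 0 1) ∧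
    ∀ t ∈ Set.Icc (0 : ℝ) 1, HasDerivAt (h ∘ stdSegment) (α.val (σ.path t)
      (mfderivWithin 𝓘(ℝ, ℝ) I σ.path (Set.Icc 0 1) t (1 : ℝ))) t := by
  obtain ⟨U, F, hU, hsub, hF, hFσ, hsm, hd⟩ := hh
  constructor
  · have h1 : ContinuousOn (fderiv ℝ h) U :=
      (((contDiffOn_infty_iff_fderiv_of_isOpen hU).1 hsm).2).continuousOn
    have h2 : ContinuousOn (fun t => fderiv ℝ h (stdSegment t) ![-1, 1]) (Set.Icc 0 1) :=
      (h1.comp continuous_stdSegment.continuousOn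
        fun t ht => hsub (stdSegment_mem ht)).clm_apply continuousOn_const
    refine h2.congr fun t ht => ?_
    refine (σ.integrand_eq α hU hsub hF hFσ ht).trans ?_
    exact congrArg (fun L : (Fin 2 → ℝ) →L[ℝ] ℝ => L ![-1, 1])
      (hd _ (hsub (stdSegment_mem ht))).fderiv.symm
  · intro t ht
    rw [σ.integrand_eq α hU hsub hF hFσ ht]
    exact (hd _ (hsub (stdSegment_mem ht))).comp_hasDerivAt t (hasDerivAt_stdSegment t)

theorem SmoothSimplex.IsPrimitive.intervalIntegrable {σ : SmoothSimplex I N 1}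
    {α : OneForm I N} {h : (Fin 2 → ℝ) → ℝ} (hh : σ.IsPrimitive α h) :
    IntervalIntegrable (fun t => α.val (σ.path t)
      (mfderivWithin 𝓘(ℝ, ℝ) I σ.path (Set.Icc 0 1) t (1 : ℝ))) MeasureTheory.volume 0 1 := by
  apply ContinuousOn.intervalIntegrable
  rw [Set.uIcc_of_le zero_le_one]
  exact hh.hasDerivAt_comp_stdSegment.1

theorem SmoothSimplex.IsPrimitive.integral_eq {σ : SmoothSimplex I N 1}
    {α : OneForm I N} {h : (Fin 2 → ℝ) → ℝ} (hh : σ.IsPrimitive α h) :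
    σ.integral α = h (Pi.single 1 1) - h (Pi.single 0 1) := by
  have := intervalIntegral.integral_eq_sub_of_hasDerivAt (a := 0) (b := 1)
    (fun t ht => hh.hasDerivAt_comp_stdSegment.2 t
      (by rwa [Set.uIcc_of_le zero_le_one] at ht)) hh.intervalIntegrable
  rw [SmoothSimplex.integral, this]
  simp only [Function.comp, stdSegment_one, stdSegment_zero]

/-- The fundamental theorem of calculus along a simplex that stays in the domain of a primitive. -/
theorem OneForm.IsPrimitiveOn.integral_eq {α : OneForm I N} {f : N → ℝ} {W : Set N}
    (hf : α.IsPrimitiveOn f W) (hW : IsOpen W) (σ : SmoothSimplex I N 1)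
    (hσ : ∀ s, σ.toFun s ∈ W) :
    σ.integral α = f (σ.toFun (stdSimplex.vertex 1)) - f (σ.toFun (stdSimplex.vertex 0)) := by
  obtain ⟨U, F, hU, hsub, hF, hFσ⟩ := σ.smooth
  have hO : IsOpen (U ∩ F ⁻¹' W) := hF.continuousOn.isOpen_inter_preimage hU hW
  have hh : σ.IsPrimitive α (f ∘ F) := by
    refine ⟨U ∩ F ⁻¹' W, F, hO, fun s hs => ⟨hsub hs, ?_⟩, hF.mono Set.inter_subset_left, hFσ, ?_,
      fun y hy => ?_⟩
    · have := hσ ⟨s, hs⟩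
      rwa [← hFσ] at this
    · exact contMDiffOn_iff_contDiffOn.1
        (hf.1.comp (hF.mono Set.inter_subset_left) fun z hz => hz.2)
    · exact hf.hasFDerivAt_comp
        ((hF.contMDiffAt (hU.mem_nhds hy.1)).mdifferentiableAt (by simp)) hy.2
  rw [hh.integral_eq, ← hFσ, ← hFσ]
  rfl

/-- On a bounded sequence of forms, the integrals over a fixed simplex are bounded. -/
theorem IsBoundedSeq.exists_abs_integral_le [FiniteDimensional ℝ E] [I.Boundaryless]
    {ρ : ℕ → OneForm I N} (hρ : IsBoundedSeq ρ) (σ : SmoothSimplex I N 1) :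
    ∃ C, ∀ j, |σ.integral (ρ j)| ≤ C := by
  obtain ⟨U, F, hU, hsub, hF, hFσ⟩ : ∃ (U : Set (Fin 2 → ℝ)) (F : (Fin 2 → ℝ) → N),
    IsOpen U ∧ stdSimplex ℝ (Fin 2) ⊆ U ∧ ContMDiffOn 𝓘(ℝ, Fin 2 → ℝ) I ∞ F U ∧
    ∀ s : stdSimplex ℝ (Fin 2), F (s : Fin 2 → ℝ) = σ.toFun s := σ.smooth
  suffices h : ∃ C, ∀ j, ∀ y ∈ stdSimplex ℝ (Fin 2), |(ρ j).pullback F y ![-1, 1]| ≤ C by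
    obtain ⟨C, hC⟩ := h
    refine ⟨C, fun j => ?_⟩
    have := intervalIntegral.norm_integral_le_of_norm_le_const (a := 0) (b := 1) (C := C)
      (f := fun t => (ρ j).val (σ.path t)
        (mfderivWithin 𝓘(ℝ, ℝ) I σ.path (Set.Icc 0 1) t (1 : ℝ))) (fun t ht => by
        rw [Set.uIoc_of_le zero_le_one] at ht
        have ht' : t ∈ Set.Icc (0 : ℝ) 1 := ⟨ht.1.le, ht.2⟩
        rw [σ.integrand_eq (ρ j) hU hsub hF hFσ ht']
        exact hC j _ (stdSegment_mem ht'))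
    rw [SmoothSimplex.integral]
    simpa using this
  refine (isCompact_stdSimplex ℝ (Fin 2)).induction_on
    (p := fun S => ∃ C, ∀ j, ∀ y ∈ S, |(ρ j).pullback F y ![-1, 1]| ≤ C) ⟨0, by simp⟩ ?_ ?_ ?_
  · rintro S T hST ⟨C, hC⟩
    exact ⟨C, fun j y hy => hC j y (hST hy)⟩
  · rintro S T ⟨C, hC⟩ ⟨D, hD⟩
    exact ⟨max C D, fun j y hy => hy.elim (fun h => (hC j y h).trans (le_max_left _ _))
      fun h => (hD j y h).trans (le_max_right _ _)⟩
  · intro y₀ hy₀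
    -- near `y₀` the simplex stays in a compact chart ball, and the derivative of its coordinate
    -- expression is bounded
    set φ := extChartAt I (F y₀) with hφ
    obtain ⟨r, hr, hrsub⟩ := Metric.nhds_basis_closedBall.mem_iff.1
      ((isOpen_extChartAt_target (I := I) (F y₀)).mem_nhds (mem_extChartAt_target (F y₀)))
    obtain ⟨C, hC⟩ := hρ (F y₀) _ (isCompact_closedBall (φ (F y₀)) r) hrsub 0
    have hO : IsOpen (U ∩ F ⁻¹' φ.source) :=
      hF.continuousOn.isOpen_inter_preimage hU (isOpen_extChartAt_source (F y₀))
    have hy₀O : y₀ ∈ U ∩ F ⁻¹' φ.source := ⟨hsub hy₀, mem_extChartAt_source (F y₀)⟩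
    have hφs : ContMDiffOn I 𝓘(ℝ, E) ∞ φ φ.source := by
      rw [hφ, extChartAt_source]; exact contMDiffOn_extChartAt
    have hsm : ContDiffOn ℝ ∞ (φ ∘ F) (U ∩ F ⁻¹' φ.source) :=
      contMDiffOn_iff_contDiffOn.1
        (hφs.comp (hF.mono Set.inter_subset_left) fun z hz => hz.2)
    have hcd := ((contDiffOn_infty_iff_fderiv_of_isOpen hO).1 hsm).2.continuousOn.continuousAt
      (hO.mem_nhds hy₀O)
    have h1 : ∀ᶠ y in nhds y₀, ‖fderiv ℝ (φ ∘ F) y‖ < ‖fderiv ℝ (φ ∘ F) y₀‖ + 1 :=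
      hcd.norm.eventually_lt_const (lt_add_one _)
    have h2 : ∀ᶠ y in nhds y₀, (φ ∘ F) y ∈ Metric.closedBall (φ (F y₀)) r :=
      (hsm.continuousOn.continuousAt (hO.mem_nhds hy₀O)).eventually
        (Metric.closedBall_mem_nhds _ hr)
    refine ⟨_, mem_nhdsWithin_of_mem_nhds (h1.and (h2.and (hO.mem_nhds hy₀O))),
      C * ((‖fderiv ℝ (φ ∘ F) y₀‖ + 1) * ‖(![-1, 1] : Fin 2 → ℝ)‖), ?_⟩
    rintro j y ⟨hy1, hy2, hyU, hys⟩
    have hCj : ‖(ρ j).chartRep (F y₀) (φ (F y))‖ ≤ C := by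
      simpa using hC j _ hy2
    have hFd : MDifferentiableAt 𝓘(ℝ, Fin 2 → ℝ) I F y :=
      (hF.contMDiffAt (hU.mem_nhds hyU)).mdifferentiableAt (by simp)
    have hφd : MDifferentiableAt I 𝓘(ℝ, E) φ (F y) :=
      mdifferentiableAt_extChartAt (by simpa [hφ, extChartAt_source] using hys)
    obtain ⟨L, hL, hd⟩ : ∃ L : (Fin 2 → ℝ) →L[ℝ] E,
        L ![-1, 1] = mfderiv I 𝓘(ℝ, E) φ (F y) (mfderiv 𝓘(ℝ, Fin 2 → ℝ) I F y ![-1, 1]) ∧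
        HasFDerivAt (φ ∘ F) L y :=
      ⟨_, rfl, hasMFDerivAt_iff_hasFDerivAt.1 (hφd.hasMFDerivAt.comp y hFd.hasMFDerivAt)⟩
    have heq : (ρ j).pullback F y ![-1, 1] =
        (ρ j).chartRep (F y₀) (φ (F y)) (fderiv ℝ (φ ∘ F) y ![-1, 1]) := by
      rw [hd.fderiv, hL]
      exact ((ρ j).chartRep_extChartAt_apply hys _).symm
    have hC0 : 0 ≤ C := (norm_nonneg _).trans hCj
    rw [heq, ← Real.norm_eq_abs]
    refine (ContinuousLinearMap.le_opNorm _ _).trans (mul_le_mul hCj ?_ (norm_nonneg _) hC0)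
    exact (ContinuousLinearMap.le_opNorm _ _).trans
      (mul_le_mul_of_nonneg_right hy1.le (norm_nonneg _))

end Simplices

/-! ### Stokes' theorem for closed 1-forms -/

section Stokes

variable {E : Type*} [NormedAddCommGroup E] [NormedSpace ℝ E]
  {H : Type*} [TopologicalSpace H] {I : ModelWithCorners ℝ E H}
  {N : Type*} [TopologicalSpace N] [ChartedSpace H N]

theorem SmoothSimplex.face_vertex {q : ℕ} (σ : SmoothSimplex I N (q + 1)) (i : Fin (q + 2))
    (j : Fin (q + 1)) :
    (σ.face i).toFun (stdSimplex.vertex j) = σ.toFun (stdSimplex.vertex (i.succAbove j)) :=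
  congrArg σ.toFun (stdSimplex.map_vertex (S := ℝ) i.succAbove j)

/-- Summation of the values of a function over a 0-chain. -/
def chainEval (f : N → ℝ) : SmoothChain I N 0 →ₗ[ℤ] ℝ :=
  Finsupp.linearCombination ℤ fun τ : SmoothSimplex I N 0 => f (τ.toFun (stdSimplex.vertex 0))

variable [IsManifold I ∞ N]

theorem SmoothSimplex.integral_smul (σ : SmoothSimplex I N 1) (c : ℝ) (α : OneForm I N) :
    σ.integral (c • α) = c * σ.integral α :=
  intervalIntegral.integral_const_mul _ _

/-- The integral of a fixed 1-form as a homomorphism on chains. -/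
def chainIntegralHom (α : OneForm I N) : SmoothChain I N 1 →ₗ[ℤ] ℝ :=
  Finsupp.linearCombination ℤ fun σ : SmoothSimplex I N 1 => σ.integral α

theorem chainIntegralHom_apply (α : OneForm I N) (c : SmoothChain I N 1) :
    chainIntegralHom α c = chainIntegral c α := by
  simp [chainIntegralHom, chainIntegral, Finsupp.linearCombination_apply]

theorem chainIntegralHom_single (α : OneForm I N) (σ : SmoothSimplex I N 1) :
    chainIntegralHom α (Finsupp.single σ 1) = σ.integral α := by
  simp [chainIntegralHom]

theorem OneForm.IsPrimitiveOn.chainIntegral_eq {α : OneForm I N} {f : N → ℝ}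
    (hf : α.IsPrimitiveOn f Set.univ) (c : SmoothChain I N 1) :
    chainIntegral c α = chainEval f (chainBoundary I N 0 c) := by
  rw [← chainIntegralHom_apply]
  have : chainIntegralHom α = (chainEval f).comp (chainBoundary I N 0) := by
    apply Finsupp.lhom_ext'
    intro σ
    apply LinearMap.ext_ring
    have h := hf.integral_eq isOpen_univ σ fun _ => trivial
    simp [chainIntegralHom, chainEval, chainBoundary, Fin.sum_univ_two, σ.face_vertex, h]
    rfl
  rw [this]
  rfl

theorem OneForm.IsExactForm.chainIntegral_eq_zero {α : OneForm I N} (hα : α.IsExactForm)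
    (z : OneCycle I N) : chainIntegral z.1 α = 0 := by
  obtain ⟨f, hf⟩ := OneForm.isExactForm_iff_exists_isPrimitiveOn.1 hα
  rw [hf.chainIntegral_eq, LinearMap.mem_ker.1 z.2, map_zero]

variable [FiniteDimensional ℝ E] [I.Boundaryless]

/-- Stokes' theorem: with a primitive of the pullback to a 2-simplex, the integrals over the faces
are differences of its values at the vertices. -/
theorem OneForm.IsClosedForm.chainIntegral_chainBoundary {α : OneForm I N} (hα : α.IsClosedForm)
    (c : SmoothChain I N 2) : chainIntegral (chainBoundary I N 1 c) α = 0 := by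
  rw [← chainIntegralHom_apply]
  have : (chainIntegralHom α).comp (chainBoundary I N 1) = 0 := by
    apply Finsupp.lhom_ext'
    intro σ
    apply LinearMap.ext_ring
    obtain ⟨h, hh⟩ := σ.exists_isPrimitive hα
    have h0 := (hh.face 0).integral_eq
    have h1 := (hh.face 1).integral_eq
    have h2 := (hh.face 2).integral_eq
    simp only [Function.comp, faceMap_single] at h0 h1 h2
    have e0 : (0 : Fin 3).succAbove (0 : Fin 2) = 1 := rfl
    have e1 : (0 : Fin 3).succAbove (1 : Fin 2) = 2 := rfl
    have e2 : (1 : Fin 3).succAbove (0 : Fin 2) = 0 := rfl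
    have e3 : (1 : Fin 3).succAbove (1 : Fin 2) = 2 := rfl
    have e4 : (2 : Fin 3).succAbove (0 : Fin 2) = 0 := rfl
    have e5 : (2 : Fin 3).succAbove (1 : Fin 2) = 1 := rfl
    rw [e0, e1] at h0
    rw [e2, e3] at h1
    rw [e4, e5] at h2
    simp [chainIntegralHom, chainBoundary, Fin.sum_univ_three, h0, h1, h2]
  exact congrArg (fun L => L c) this

theorem SmoothSimplex.integral_add (σ : SmoothSimplex I N 1) {α β : OneForm I N}
    (hα : α.IsClosedForm) (hβ : β.IsClosedForm) :
    σ.integral (α + β) = σ.integral α + σ.integral β := by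
  obtain ⟨h, hh⟩ := σ.exists_isPrimitive hα
  obtain ⟨k, hk⟩ := σ.exists_isPrimitive hβ
  exact intervalIntegral.integral_add hh.intervalIntegrable hk.intervalIntegrable

/-- The integral over a fixed chain as a linear functional on closed 1-forms. -/
def closedIntegral (c : SmoothChain I N 1) : closedForms I N →ₗ[ℝ] ℝ where
  toFun α := chainIntegral c α.1
  map_add' α β := by
    simp only [chainIntegral, Finsupp.sum]
    rw [← Finset.sum_add_distrib]
    refine Finset.sum_congr rfl fun σ _ => ?_
    rw [← mul_add, ← σ.integral_add α.2 β.2]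
    rfl
  map_smul' r α := by
    simp only [chainIntegral, Finsupp.sum, RingHom.id_apply, smul_eq_mul]
    rw [Finset.mul_sum]
    refine Finset.sum_congr rfl fun σ _ => ?_
    rw [mul_left_comm r]
    exact congrArg ((c σ : ℝ) * ·) (σ.integral_smul r α.1)

theorem IsBoundedSeq.exists_abs_chainIntegral_le {ρ : ℕ → OneForm I N} (hρ : IsBoundedSeq ρ)
    (c : SmoothChain I N 1) : ∃ C, ∀ j, |chainIntegral c (ρ j)| ≤ C := by
  choose C hC using hρ.exists_abs_integral_le
  refine ⟨∑ σ ∈ c.support, |(c σ : ℝ)| * C σ, fun j => ?_⟩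
  refine (Finset.abs_sum_le_sum_abs _ _).trans (Finset.sum_le_sum fun σ _ => ?_)
  rw [abs_mul]
  exact mul_le_mul_of_nonneg_left (hC σ j) (abs_nonneg _)

end Stokes

/-! ### Closed 1-forms with vanishing periods are exact -/

section Exactness

variable {E : Type*} [NormedAddCommGroup E] [NormedSpace ℝ E]
  {H : Type*} [TopologicalSpace H] {I : ModelWithCorners ℝ E H}
  {N : Type*} [TopologicalSpace N] [ChartedSpace H N]

variable (I) in
/-- The 0-simplex at a point. -/
def pointSimplex (p : N) : SmoothSimplex I N 0 where
  toFun _ := p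
  smooth := ⟨Set.univ, fun _ => p, isOpen_univ, Set.subset_univ _, contMDiffOn_const, fun _ => rfl⟩

theorem SmoothSimplex.eq_pointSimplex (τ : SmoothSimplex I N 0) :
    τ = pointSimplex I (τ.toFun (stdSimplex.vertex 0)) := by
  obtain ⟨f, hf⟩ := τ
  have : f = fun _ => f (stdSimplex.vertex 0) := funext fun s =>
    congrArg f (Subsingleton.elim _ _)
  simp only [pointSimplex]
  congr

/-- `c` is a smooth 1-chain from `p` to `q`. -/
def SmoothChain.Joins (c : SmoothChain I N 1) (p q : N) : Prop :=
  chainBoundary I N 0 c =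
    Finsupp.single (pointSimplex I q) 1 - Finsupp.single (pointSimplex I p) 1

theorem SmoothSimplex.joins (σ : SmoothSimplex I N 1) :
    SmoothChain.Joins (Finsupp.single σ 1) (σ.toFun (stdSimplex.vertex 0))
      (σ.toFun (stdSimplex.vertex 1)) := by
  have h0 : σ.face 0 = pointSimplex I (σ.toFun (stdSimplex.vertex 1)) := by
    rw [(σ.face 0).eq_pointSimplex]
    exact congrArg (fun s => pointSimplex I (σ.toFun s))
      (stdSimplex.map_vertex (S := ℝ) (Fin.succAbove 0) (0 : Fin 1))
  have h1 : σ.face 1 = pointSimplex I (σ.toFun (stdSimplex.vertex 0)) := by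
    rw [(σ.face 1).eq_pointSimplex]
    exact congrArg (fun s => pointSimplex I (σ.toFun s))
      (stdSimplex.map_vertex (S := ℝ) (Fin.succAbove 1) (0 : Fin 1))
  simp [SmoothChain.Joins, chainBoundary, Fin.sum_univ_two, h0, h1, sub_eq_add_neg]

variable (I N) in
/-- Being joined by a smooth 1-chain. -/
def chainSetoid : Setoid N where
  r p q := ∃ c : SmoothChain I N 1, c.Joins p q
  iseqv := by
    refine ⟨fun p => ⟨0, by simp [SmoothChain.Joins]⟩, ?_, ?_⟩
    · rintro p q ⟨c, hc⟩
      refine ⟨-c, ?_⟩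
      rw [SmoothChain.Joins] at *
      rw [map_neg, hc, neg_sub]
    · rintro p q r ⟨c, hc⟩ ⟨c', hc'⟩
      refine ⟨c + c', ?_⟩
      rw [SmoothChain.Joins] at *
      rw [map_add, hc, hc']
      abel

variable [IsManifold I ∞ N]

/-- The smooth 1-simplex that is a segment in a chart ball. -/
theorem exists_smoothSimplex_of_mem_ball (p₀ : N) {y : E} {r : ℝ}
    (hr : Metric.ball y r ⊆ (extChartAt I p₀).target) {p q : N}
    (hp : p ∈ (extChartAt I p₀).source ∩ extChartAt I p₀ ⁻¹' Metric.ball y r)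
    (hq : q ∈ (extChartAt I p₀).source ∩ extChartAt I p₀ ⁻¹' Metric.ball y r) :
    ∃ σ : SmoothSimplex I N 1, σ.toFun (stdSimplex.vertex 0) = p ∧
      σ.toFun (stdSimplex.vertex 1) = q ∧
      ∀ s, σ.toFun s ∈ (extChartAt I p₀).source ∩ extChartAt I p₀ ⁻¹' Metric.ball y r := by
  set φ := extChartAt I p₀ with hφ
  let L : (Fin 2 → ℝ) → E := fun s => s 0 • φ p + s 1 • φ q
  have hL : ContDiff ℝ ∞ L := by fun_prop
  have hLmem : ∀ s ∈ stdSimplex ℝ (Fin 2), L s ∈ Metric.ball y r := fun s hs =>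
    convex_ball y r hp.2 hq.2 (hs.1 0) (hs.1 1) (by simpa using hs.2)
  refine ⟨⟨fun s => φ.symm (L s), L ⁻¹' Metric.ball y r, fun s => φ.symm (L s),
    Metric.isOpen_ball.preimage hL.continuous, hLmem, ?_, fun s => rfl⟩, ?_, ?_, ?_⟩
  · exact ((contMDiffOn_extChartAt_symm p₀).mono hr).comp hL.contMDiff.contMDiffOn fun s hs => hs
  · simp [L, φ.left_inv hp.1]
  · simp [L, φ.left_inv hq.1]
  · intro s
    have h := hLmem s s.2
    refine ⟨φ.map_target (hr h), ?_⟩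
    rw [Set.mem_preimage, φ.right_inv (hr h)]
    exact h

variable [I.Boundaryless] [FiniteDimensional ℝ E]

/-- A closed form with vanishing integrals over all cycles is exact: its integral along chains from
a base point chosen in each component is a primitive, since on chart balls it differs from a local
primitive by a constant. -/
theorem OneForm.IsClosedForm.isExactForm_of_chainIntegral_eq_zero {α : OneForm I N}
    (hα : α.IsClosedForm) (h : ∀ z : OneCycle I N, chainIntegral z.1 α = 0) :
    α.IsExactForm := by
  let base : N → N := fun p => (Quotient.mk (chainSetoid I N) p).out
  have hbase : ∀ p, ∃ c : SmoothChain I N 1, c.Joins (base p) p := fun p =>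
    Quotient.mk_out (s := chainSetoid I N) p
  choose c hc using hbase
  let f : N → ℝ := fun p => chainIntegral (c p) α
  have hf : ∀ (p q : N) (e : SmoothChain I N 1), e.Joins p q → f q = f p + chainIntegral e α := by
    intro p q e he
    have hb : base p = base q :=
      congrArg Quotient.out (Quotient.sound (s := chainSetoid I N) ⟨e, he⟩)
    have hz : c p + e - c q ∈ OneCycle I N := by
      have hp := hc p
      have hq := hc q
      rw [SmoothChain.Joins] at hp hq he
      rw [LinearMap.mem_ker, map_sub, map_add, hp, hq, he, hb]
      abel
    have h1 := h ⟨_, hz⟩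
    simp only [← chainIntegralHom_apply, map_sub, map_add] at h1
    simp only [f, ← chainIntegralHom_apply]
    linarith
  rw [OneForm.isExactForm_iff_exists_isPrimitiveOn]
  have key : ∀ p₀ : N, ContMDiffAt I 𝓘(ℝ, ℝ) ∞ f p₀ ∧
      HasMFDerivAt I 𝓘(ℝ, ℝ) f p₀ (α.val p₀) := by
    intro p₀
    obtain ⟨r, hr, hsub⟩ := Metric.isOpen_iff.1 (isOpen_extChartAt_target (I := I) p₀) _
      (mem_extChartAt_target p₀)
    obtain ⟨g, hg⟩ := hα.exists_isPrimitiveOn_ball p₀ hsub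
    have hW : IsOpen ((extChartAt I p₀).source ∩
        extChartAt I p₀ ⁻¹' Metric.ball (extChartAt I p₀ p₀) r) :=
      isOpen_extChartAt_preimage' p₀ Metric.isOpen_ball
    have hp₀ : p₀ ∈ (extChartAt I p₀).source ∩
        extChartAt I p₀ ⁻¹' Metric.ball (extChartAt I p₀ p₀) r :=
      ⟨mem_extChartAt_source p₀, Metric.mem_ball_self hr⟩
    have heq : f =ᶠ[nhds p₀] fun q => g q + (f p₀ - g p₀) := by
      filter_upwards [hW.mem_nhds hp₀] with q hq
      obtain ⟨σ, h0, h1, hσ⟩ := exists_smoothSimplex_of_mem_ball p₀ hsub hp₀ hq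
      have hj := σ.joins
      rw [h0, h1] at hj
      rw [hf _ _ _ hj, ← chainIntegralHom_apply, chainIntegralHom_single,
        hg.integral_eq hW σ hσ, h0, h1]
      ring
    constructor
    · exact ((hg.1.contMDiffAt (hW.mem_nhds hp₀)).add contMDiffAt_const).congr_of_eventuallyEq heq
    · have h1 := (hg.2 p₀ hp₀).add (hasMFDerivAt_const (I := I) (I' := 𝓘(ℝ, ℝ)) (f p₀ - g p₀) p₀)
      have h2 := h1.congr_of_eventuallyEq heq
      exact h2.congr_mfderiv (add_zero _)
  exact ⟨f, fun p _ => (key p).1.contMDiffWithinAt, fun p _ => (key p).2⟩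

end Exactness

/-! ### The Diophantine condition and sequences of integer vectors -/

section Diophantine

theorem abs_apply_le_euclNorm {ι : Type*} [Fintype ι] (v : ι → ℝ) (i : ι) : |v i| ≤ euclNorm v :=
  PiLp.norm_apply_le (WithLp.toLp 2 v) i

theorem euclNorm_nonneg {ι : Type*} [Fintype ι] (v : ι → ℝ) : 0 ≤ euclNorm v := norm_nonneg _

theorem euclNorm_smul {ι : Type*} [Fintype ι] (c : ℝ) (v : ι → ℝ) :
    euclNorm (c • v) = |c| * euclNorm v :=
  norm_smul c (WithLp.toLp 2 v)

theorem euclNorm_le_add {ι : Type*} [Fintype ι] (u v : ι → ℝ) :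
    euclNorm u ≤ euclNorm (u + v) + euclNorm v :=
  norm_le_add_norm_add (WithLp.toLp 2 u) (WithLp.toLp 2 v)

theorem euclNorm_le_sum_abs {ι : Type*} [Fintype ι] (v : ι → ℝ) : euclNorm v ≤ ∑ i, |v i| := by
  rw [euclNorm, EuclideanSpace.norm_eq]
  refine Real.sqrt_le_iff.2 ⟨Finset.sum_nonneg fun i _ => abs_nonneg _, ?_⟩
  exact Finset.sum_sq_le_sq_sum_of_nonneg fun i _ => abs_nonneg _

theorem one_le_euclNorm_intCast {ι : Type*} [Fintype ι] {ξ : ι → ℤ} (hξ : ξ ≠ 0) :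
    1 ≤ euclNorm fun i => (ξ i : ℝ) := by
  obtain ⟨i, hi⟩ := Function.ne_iff.1 hξ
  refine le_trans ?_ (abs_apply_le_euclNorm _ i)
  exact_mod_cast Int.one_le_abs hi

theorem finite_euclNorm_intCast_le {ι : Type*} [Fintype ι] (R : ℝ) :
    {ξ : ι → ℤ | euclNorm (fun i => (ξ i : ℝ)) ≤ R}.Finite := by
  classical
  refine (Set.finite_Icc (fun _ : ι => -⌈R⌉) (fun _ => ⌈R⌉)).subset fun ξ hξ => ?_
  have h : ∀ i, |ξ i| ≤ ⌈R⌉ := fun i => by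
    have := ((abs_apply_le_euclNorm (fun i => (ξ i : ℝ)) i).trans hξ).trans (Int.le_ceil R)
    exact_mod_cast this
  exact ⟨fun i => (abs_le.1 (h i)).1, fun i => (abs_le.1 (h i)).2⟩

variable {m d : ℕ} (A : Matrix (Fin d) (Fin m) ℝ)

theorem exists_euclNorm_mulVec_le :
    ∃ B, 0 ≤ B ∧ ∀ v, euclNorm (A.mulVec v) ≤ B * euclNorm v := by
  let T := LinearMap.toContinuousLinearMap (Matrix.toEuclideanLin A)
  exact ⟨‖T‖, norm_nonneg _, fun v => T.le_opNorm (WithLp.toLp 2 v)⟩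

/-- The integer vectors in a bounded region stay away from resonance, so that violations of the
Diophantine estimate with small constants are attained at large `ξ` only. -/
theorem exists_seq_of_not_satisfiesDC
    (hA : ∀ (ξ : Fin m → ℤ) (η : Fin d → ℤ), ξ ≠ 0 →
      (fun ℓ => (η ℓ : ℝ)) + A.mulVec (fun k => (ξ k : ℝ)) ≠ 0)
    (hDC : ¬ SatisfiesDC A) :
    ∃ (ξ : ℕ → Fin m → ℤ) (η : ℕ → Fin d → ℤ),
      Filter.Tendsto (fun j => euclNorm fun k => (ξ j k : ℝ)) Filter.atTop Filter.atTop ∧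
      ∀ j, (euclNorm fun k => (ξ j k : ℝ)) ^ j *
        euclNorm ((fun ℓ => (η j ℓ : ℝ)) + A.mulVec (fun k => (ξ j k : ℝ))) ≤ 1 := by
  obtain ⟨B, hB0, hB⟩ := exists_euclNorm_mulVec_le A
  have step : ∀ j : ℕ, ∃ (ξ : Fin m → ℤ) (η : Fin d → ℤ),
      (j : ℝ) ≤ euclNorm (fun k => (ξ k : ℝ)) ∧ (euclNorm fun k => (ξ k : ℝ)) ^ j *
        euclNorm ((fun ℓ => (η ℓ : ℝ)) + A.mulVec (fun k => (ξ k : ℝ))) ≤ 1 := by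
    intro j
    set T : Set ((Fin m → ℤ) × (Fin d → ℤ)) :=
      ({ξ | euclNorm (fun i => (ξ i : ℝ)) ≤ j} ×ˢ
        {η | euclNorm (fun i => (η i : ℝ)) ≤ 1 + B * j}) ∩ {x | x.1 ≠ 0} with hT
    have hTf : T.Finite := ((finite_euclNorm_intCast_le _).prod
      (finite_euclNorm_intCast_le _)).inter_of_left _
    have hpos : ∀ x ∈ T, 0 <
        euclNorm ((fun ℓ => (x.2 ℓ : ℝ)) + A.mulVec (fun k => (x.1 k : ℝ))) := by
      intro x hx
      refine norm_pos_iff.2 fun h0 => hA x.1 x.2 hx.2 ?_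
      exact congrArg WithLp.ofLp h0
    have hev : ∀ᶠ c in nhdsWithin (0 : ℝ) (Set.Ioi 0), ∀ x ∈ T, c <
        euclNorm ((fun ℓ => (x.2 ℓ : ℝ)) + A.mulVec (fun k => (x.1 k : ℝ))) :=
      (Filter.eventually_all_finite hTf).2 fun x hx =>
        mem_nhdsWithin_of_mem_nhds (Iio_mem_nhds (hpos x hx))
    have hev1 : ∀ᶠ c in nhdsWithin (0 : ℝ) (Set.Ioi 0), c < 1 :=
      mem_nhdsWithin_of_mem_nhds (Iio_mem_nhds one_pos)
    have hev0 : ∀ᶠ c in nhdsWithin (0 : ℝ) (Set.Ioi 0), 0 < c := self_mem_nhdsWithin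
    -- `c < 1` excludes `ξ = 0` and makes `η` bounded by `ξ`; smallness on `T` excludes `|ξ| < j`
    obtain ⟨c, hcT, hc1, hc0⟩ := (hev.and (hev1.and hev0)).exists
    simp only [SatisfiesDC, not_exists, not_and, not_forall, not_le] at hDC
    -- the exponent `j` would do, but it has to be positive also for `j = 0`
    obtain ⟨ξ, η, hne, hlt⟩ := hDC c hc0 (j + 1) (by positivity)
    set x := euclNorm (fun k => (ξ k : ℝ)) with hx
    set y := euclNorm (fun ℓ => (η ℓ : ℝ)) with hy
    set D := euclNorm ((fun ℓ => (η ℓ : ℝ)) + A.mulVec (fun k => (ξ k : ℝ))) with hD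
    have hx0 : 0 ≤ x := euclNorm_nonneg _
    have hy0 : 0 ≤ y := euclNorm_nonneg _
    have hs : 1 ≤ y + x := by
      by_cases h : ξ = 0
      · have hη : η ≠ 0 := fun h' => hne (by rw [h, h']; rfl)
        linarith [one_le_euclNorm_intCast hη]
      · linarith [one_le_euclNorm_intCast h]
    have hpow : (y + x) ^ (-((j : ℝ) + 1)) ≤ 1 :=
      Real.rpow_le_one_of_one_le_of_nonpos hs (by linarith [(Nat.cast_nonneg j : (0 : ℝ) ≤ j)])
    have hDc : D < c := hlt.trans_le (mul_le_of_le_one_right hc0.le hpow)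
    have hξ : ξ ≠ 0 := by
      rintro rfl
      have hη : η ≠ 0 := fun h' => hne (by rw [h']; rfl)
      have h1 := one_le_euclNorm_intCast hη
      have h2 : D = y := by
        have : (fun k : Fin m => (((0 : Fin m → ℤ) k : ℤ) : ℝ)) = 0 := by ext; simp
        rw [hD, this, Matrix.mulVec_zero, add_zero]
      linarith
    have hyle : y ≤ D + B * x := (euclNorm_le_add _ _).trans (by gcongr; exact hB _)
    have hjx : (j : ℝ) ≤ x := by
      by_contra! hlt'
      have hmem : (ξ, η) ∈ T :=
        ⟨⟨hlt'.le, hyle.trans (add_le_add (by linarith)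
          (mul_le_mul_of_nonneg_left hlt'.le hB0))⟩, hξ⟩
      exact (hcT _ hmem).not_gt hDc
    refine ⟨ξ, η, hjx, ?_⟩
    have h1 : (y + x) ^ (-((j : ℝ) + 1)) ≤ (y + x) ^ (-(j : ℝ)) :=
      Real.rpow_le_rpow_of_exponent_le hs (by linarith)
    have hDle : D ≤ (y + x) ^ (-(j : ℝ)) :=
      hlt.le.trans ((mul_le_of_le_one_left (Real.rpow_nonneg (by linarith) _) hc1.le).trans h1)
    rw [Real.rpow_neg (by linarith), Real.rpow_natCast] at hDle
    calc x ^ j * D ≤ (y + x) ^ j * ((y + x) ^ j)⁻¹ := by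
          have hD0 : 0 ≤ D := euclNorm_nonneg _
          gcongr
          linarith
      _ = 1 := mul_inv_cancel₀ (by positivity)
  choose ξ η h1 h2 using step
  exact ⟨ξ, η, Filter.tendsto_atTop_mono h1 tendsto_natCast_atTop_atTop, h2⟩

/-- Under the Diophantine condition, `|η_j + A ξ_j|` cannot decay faster than every power of
`|ξ_j| → ∞`; the vectors `η_j` are harmless because `|η_j|` is at most a multiple of `|ξ_j|`. -/
theorem SatisfiesDC.not_superpolynomial {A : Matrix (Fin d) (Fin m) ℝ} (hA : SatisfiesDC A)
    {ξ : ℕ → Fin m → ℤ} (η : ℕ → Fin d → ℤ)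
    (hξ : Filter.Tendsto (fun j => euclNorm fun k => (ξ j k : ℝ)) Filter.atTop Filter.atTop)
    {K : ℝ} (hK : ∀ j, (euclNorm fun k => (ξ j k : ℝ)) ^ j *
        euclNorm ((fun ℓ => (η j ℓ : ℝ)) + A.mulVec (fun k => (ξ j k : ℝ))) ≤ K) : False := by
  obtain ⟨B, hB0, hB⟩ := exists_euclNorm_mulVec_le A
  obtain ⟨C, hC, ρ, hρ, hDC⟩ := hA
  have hK0 : 0 ≤ K := le_trans
    (mul_nonneg (pow_nonneg (euclNorm_nonneg _) _) (euclNorm_nonneg _)) (hK 0)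
  set L := K + B + 1 with hL
  have hL0 : 0 < L := by positivity
  obtain ⟨j, hj1, hjρ, hjbig⟩ := ((hξ.eventually_ge_atTop 1).and
    ((Filter.eventually_ge_atTop ⌈ρ + 1⌉₊).and
      (hξ.eventually_gt_atTop (K * L ^ ρ / C)))).exists
  have hjρ' : ρ + 1 ≤ (j : ℝ) := Nat.ceil_le.1 hjρ
  have hDCj := hDC (ξ j) (η j) (by
    intro h
    have h0 : ξ j = 0 := congrArg Prod.fst h
    have h1 : euclNorm (fun k => (ξ j k : ℝ)) = 0 := by
      have : (fun k => (ξ j k : ℝ)) = 0 := by ext; simp [h0]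
      rw [this]; exact norm_zero
    linarith)
  have hKj := hK j
  set x := euclNorm (fun k => (ξ j k : ℝ)) with hx
  set y := euclNorm (fun ℓ => (η j ℓ : ℝ)) with hy
  set D := euclNorm ((fun ℓ => (η j ℓ : ℝ)) + A.mulVec (fun k => (ξ j k : ℝ))) with hD
  have hx0 : 0 < x := by linarith
  have hD0 : 0 ≤ D := euclNorm_nonneg _
  have hDK : D ≤ K := le_trans (le_mul_of_one_le_left hD0 (one_le_pow₀ hj1)) hKj
  have hyle : y ≤ D + B * x := (euclNorm_le_add _ _).trans (by gcongr; exact hB _)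
  have hs : y + x ≤ L * x := by nlinarith
  have hs0 : 0 < y + x := by
    have : 0 ≤ y := euclNorm_nonneg _
    linarith
  -- `C (L x) ^ (-ρ) ≤ D` and `x ^ j * D ≤ K` bound `x` once `j ≥ ρ + 1`
  have h1 : C * (L * x) ^ (-ρ) ≤ D :=
    (mul_le_mul_of_nonneg_left (Real.rpow_le_rpow_of_nonpos hs0 hs (by linarith)) hC.le).trans hDCj
  have h2 : x ^ ρ * x ≤ x ^ j := by
    rw [← Real.rpow_natCast, ← Real.rpow_add_one hx0.ne']
    exact Real.rpow_le_rpow_of_exponent_le hj1 hjρ'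
  have h3 : x ^ ρ * x * (C * (L * x) ^ (-ρ)) ≤ K :=
    (mul_le_mul h2 h1 (by positivity) (by positivity)).trans hKj
  have hLρ : 0 < L ^ ρ := Real.rpow_pos_of_pos hL0 ρ
  have hxρ : 0 < x ^ ρ := Real.rpow_pos_of_pos hx0 ρ
  rw [Real.rpow_neg (by positivity), Real.mul_rpow hL0.le hx0.le] at h3
  have h4 : x ^ ρ * x * (C * (L ^ ρ * x ^ ρ)⁻¹) = x * C / L ^ ρ := by
    field_simp
  rw [h4, div_le_iff₀ hLρ] at h3
  rw [div_lt_iff₀ hC] at hjbig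
  linarith

end Diophantine

/-! ### Periods of closed 1-forms -/

section Periods

variable {E : Type*} [NormedAddCommGroup E] [NormedSpace ℝ E] [FiniteDimensional ℝ E]
  {H : Type*} [TopologicalSpace H] {I : ModelWithCorners ℝ E H} [I.Boundaryless]
  {N : Type*} [TopologicalSpace N] [ChartedSpace H N] [IsManifold I ∞ N]

/-- Integrals over cycles of closed forms see the classes in the free part of `H₁` only. -/
theorem exists_chainIntegral_eq_sum {ι : Type*} [Fintype ι] (σ : ι → OneCycle I N)
    (hσ : Submodule.span ℤ (Set.range fun i => freeClass (σ i)) = ⊤) (z : OneCycle I N) :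
    ∃ a : ι → ℤ, ∀ α : OneForm I N, α.IsClosedForm →
      chainIntegral z.1 α = ∑ i, a i * chainIntegral (σ i).1 α := by
  let π : OneCycle I N →ₗ[ℤ] FreeH1 I N :=
    (Submodule.mkQ (Submodule.torsion ℤ (SingularH1 I N))).comp (Submodule.mkQ _)
  have hz : freeClass z ∈ Submodule.span ℤ (Set.range fun i => freeClass (σ i)) := by
    rw [hσ]; trivial
  obtain ⟨a, ha⟩ := (Submodule.mem_span_range_iff_exists_fun ℤ).1 hz
  refine ⟨a, fun α hα => ?_⟩
  set w := z - ∑ i, a i • σ i with hw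
  have hπ : π w = 0 := by
    rw [hw, map_sub, map_sum]
    simp only [map_smul]
    exact sub_eq_zero.2 ha.symm
  have htor := (Submodule.Quotient.mk_eq_zero _).1 hπ
  obtain ⟨n, hn⟩ := (Submodule.mem_torsion_iff _).1 htor
  have hn' : (Submodule.Quotient.mk ((n : ℤ) • w) : SingularH1 I N) = 0 := hn
  obtain ⟨c, hc⟩ := (Submodule.Quotient.mk_eq_zero _).1 hn'
  have h0 := hα.chainIntegral_chainBoundary c
  rw [hc] at h0
  have hn0 : ((n : ℤ) : ℝ) ≠ 0 := by exact_mod_cast nonZeroDivisors.ne_zero n.2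
  have h1 : chainIntegralHom α w.1 = 0 := by
    have h2 : chainIntegralHom α ((n : ℤ) • w.1) = 0 := by
      rw [chainIntegralHom_apply]; exact h0
    rw [map_smul, zsmul_eq_mul] at h2
    exact (mul_eq_zero.1 h2).resolve_left hn0
  have h3 : w.1 = z.1 - ∑ i, a i • (σ i).1 := by simp [hw]
  rw [h3, map_sub, map_sum, sub_eq_zero] at h1
  simpa [chainIntegralHom_apply] using h1

theorem isBoundedSeq_sum_smul {ι : Type*} [Fintype ι] (φ : ι → OneForm I N) {c : ℕ → ι → ℝ}
    {K : ℝ} (hc : ∀ j i, |c j i| ≤ K) : IsBoundedSeq fun j => ∑ i, c j i • φ i := by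
  intro p₀ S hS hSsub r
  have hcont : ∀ i, ∃ C, ∀ y ∈ S, ‖iteratedFDeriv ℝ r ((φ i).chartRep p₀) y‖ ≤ C := by
    intro i
    have ho := isOpen_extChartAt_target (I := I) p₀
    have h1 := ((φ i).chartRep_contDiffOn p₀).continuousOn_iteratedFDerivWithin
      (m := r) (by exact_mod_cast le_top) ho.uniqueDiffOn
    exact hS.exists_bound_of_continuousOn
      ((h1.congr fun y hy => (iteratedFDerivWithin_of_isOpen r ho hy).symm).mono hSsub)
  choose C hC using hcont
  refine ⟨∑ i, K * C i, fun j y hy => ?_⟩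
  have hat : ∀ i, ContDiffAt ℝ r ((φ i).chartRep p₀) y := fun i =>
    (((φ i).chartRep_contDiffOn p₀).contDiffAt
      ((isOpen_extChartAt_target (I := I) p₀).mem_nhds (hSsub hy))).of_le
      (by exact_mod_cast le_top)
  have hrep : (∑ i, c j i • φ i : OneForm I N).chartRep p₀ =
      ∑ i, c j i • (φ i).chartRep p₀ := by
    let R : OneForm I N →+ (E → E →L[ℝ] ℝ) :=
      { toFun := fun α => α.chartRep p₀, map_zero' := rfl, map_add' := fun α β => rfl }
    exact map_sum R _ _
  rw [hrep, iteratedFDeriv_sum_apply (f := fun i => c j i • (φ i).chartRep p₀)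
    fun i _ => (hat i).const_smul (c j i)]
  refine (norm_sum_le _ _).trans (Finset.sum_le_sum fun i _ => ?_)
  rw [iteratedFDeriv_const_smul_apply (hat i), norm_smul]
  exact mul_le_mul (hc j i) (hC i y hy) (norm_nonneg _) ((abs_nonneg _).trans (hc j i))

end Periods

/-! ### The periods on `H¹_{∂M}(M)` -/

namespace ScatteringManifold

variable {n : ℕ} {Mbar M bM : Type*}
  [TopologicalSpace Mbar] [ChartedSpace (EuclideanHalfSpace (n + 1)) Mbar]
  [IsManifold (𝓡∂ (n + 1)) ∞ Mbar]
  [TopologicalSpace M] [ChartedSpace (EuclideanSpace ℝ (Fin (n + 1))) M]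
  [IsManifold (𝓡 (n + 1)) ∞ M]
  [TopologicalSpace bM] [ChartedSpace (EuclideanSpace ℝ (Fin n)) bM]
  [IsManifold (𝓡 n) ∞ bM]

/-- The vector `(1 / 2π) ∫_{σ_ℓ} α`, `1 ≤ ℓ ≤ d`, of periods of a closed form. -/
def periodMap {d e : ℕ} (σ : Fin (d + e) → OneCycle (𝓡 (n + 1)) M) :
    closedForms (𝓡 (n + 1)) M →ₗ[ℝ] (Fin d → ℝ) :=
  LinearMap.pi fun ℓ => (1 / (2 * Real.pi)) • closedIntegral (σ (Fin.castAdd e ℓ)).1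

theorem periodMap_apply {d e : ℕ} (σ : Fin (d + e) → OneCycle (𝓡 (n + 1)) M)
    (α : closedForms (𝓡 (n + 1)) M) (ℓ : Fin d) :
    periodMap σ α ℓ = 1 / (2 * Real.pi) * chainIntegral (σ (Fin.castAdd e ℓ)).1 α.1 := rfl

theorem chainIntegral_castAdd {d e : ℕ} (σ : Fin (d + e) → OneCycle (𝓡 (n + 1)) M)
    (α : closedForms (𝓡 (n + 1)) M) (ℓ : Fin d) :
    chainIntegral (σ (Fin.castAdd e ℓ)).1 α.1 = 2 * Real.pi * periodMap σ α ℓ := by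
  rw [periodMap_apply, ← mul_assoc, mul_one_div_cancel Real.two_pi_pos.ne', one_mul]

variable (S : ScatteringManifold n Mbar M bM)

theorem isClosedForm_of_mem_boundaryForms {α : OneForm (𝓡 (n + 1)) M}
    (hα : α ∈ S.boundaryForms) : α.IsClosedForm := by
  obtain ⟨a, _, rfl⟩ := hα
  exact a.2

theorem combo_mem_boundaryForms {m : ℕ} {om : Fin m → OneForm (𝓡 (n + 1)) M}
    (hω : ∀ k, om k ∈ S.boundaryForms) (ξ : Fin m → ℤ) : combo ξ om ∈ S.boundaryForms :=
  Submodule.sum_mem _ fun k _ => Submodule.smul_mem _ _ (hω k)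

theorem periodMap_combo {m d e : ℕ} (σ : Fin (d + e) → OneCycle (𝓡 (n + 1)) M)
    {om : Fin m → OneForm (𝓡 (n + 1)) M} (hω : ∀ k, om k ∈ S.boundaryForms) (ξ : Fin m → ℤ) :
    periodMap σ ⟨combo ξ om,
        S.isClosedForm_of_mem_boundaryForms (S.combo_mem_boundaryForms hω ξ)⟩ =
      (periodMatrix σ om).mulVec fun k => (ξ k : ℝ) := by
  have h : (⟨combo ξ om,
      S.isClosedForm_of_mem_boundaryForms (S.combo_mem_boundaryForms hω ξ)⟩ :
      closedForms (𝓡 (n + 1)) M) =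
      ∑ k, (ξ k : ℝ) • ⟨om k, S.isClosedForm_of_mem_boundaryForms (hω k)⟩ := by
    ext1
    simp [combo]
  rw [h, map_sum]
  ext ℓ
  simp [periodMap_apply, Matrix.mulVec, dotProduct, periodMatrix, mul_comm]

variable {S} {d e : ℕ} {σ : Fin (d + e) → OneCycle (𝓡 (n + 1)) M}

/-- All integrals over cycles are integer combinations of `2π` times the first `d` periods. -/
theorem IsAdapted.exists_chainIntegral_eq (hσ : S.IsAdapted σ) (z : OneCycle (𝓡 (n + 1)) M) :
    ∃ a : Fin d → ℤ, ∀ α : closedForms (𝓡 (n + 1)) M, α.1 ∈ S.boundaryForms →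
      chainIntegral z.1 α.1 = 2 * Real.pi * ∑ ℓ, a ℓ * periodMap σ α ℓ := by
  obtain ⟨a, ha⟩ := exists_chainIntegral_eq_sum σ hσ.span_eq_top z
  refine ⟨fun ℓ => a (Fin.castAdd e ℓ), fun α hα => ?_⟩
  rw [ha α.1 α.2, Fin.sum_univ_add, Finset.mul_sum]
  simp only [hσ.integral_eq_zero α.1 hα, mul_zero, Finset.sum_const_zero, add_zero]
  refine Finset.sum_congr rfl fun ℓ _ => ?_
  rw [chainIntegral_castAdd]
  ring

theorem IsAdapted.isIntegral_iff (hσ : S.IsAdapted σ) {α : closedForms (𝓡 (n + 1)) M}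
    (hα : α.1 ∈ S.boundaryForms) :
    S.IsIntegral α.1 ↔ ∃ η : Fin d → ℤ, periodMap σ α = fun ℓ => (η ℓ : ℝ) := by
  constructor
  · rintro ⟨_, h⟩
    choose η hη using fun ℓ : Fin d => h (σ (Fin.castAdd e ℓ))
    refine ⟨η, funext fun ℓ => ?_⟩
    have := hη ℓ
    rw [chainIntegral_castAdd] at this
    exact mul_left_cancel₀ Real.two_pi_pos.ne' this
  · rintro ⟨η, hη⟩
    refine ⟨hα, fun z => ?_⟩
    obtain ⟨a, ha⟩ := hσ.exists_chainIntegral_eq z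
    refine ⟨∑ ℓ, a ℓ * η ℓ, ?_⟩
    rw [ha α hα, hη]
    push_cast
    rfl

/-- A form with class in `H¹_{∂M}(M)` is determined by its periods up to exact forms. -/
theorem IsAdapted.isExactForm_of_periodMap_eq_zero (hσ : S.IsAdapted σ)
    {α : closedForms (𝓡 (n + 1)) M} (hα : α.1 ∈ S.boundaryForms) (h : periodMap σ α = 0) :
    α.1.IsExactForm := by
  refine OneForm.IsClosedForm.isExactForm_of_chainIntegral_eq_zero α.2 fun z => ?_
  obtain ⟨a, ha⟩ := hσ.exists_chainIntegral_eq z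
  rw [ha α hα, h]
  simp

/-- The periods define an injection of `H¹_{∂M}(M)` into `ℝ^d`, which is onto because the dimensions
agree. -/
theorem IsAdapted.exists_periodMap_eq (hσ : S.IsAdapted σ) (v : Fin d → ℝ) :
    ∃ α : closedForms (𝓡 (n + 1)) M, α.1 ∈ S.boundaryForms ∧ periodMap σ α = v := by
  let P : DeRhamH1 (𝓡 (n + 1)) M →ₗ[ℝ] (Fin d → ℝ) :=
    Submodule.liftQ _ (periodMap σ) fun α hα => by
      refine LinearMap.mem_ker.2 (funext fun ℓ => ?_)
      rw [periodMap_apply, OneForm.IsExactForm.chainIntegral_eq_zero (α := α.1) hα, mul_zero]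
      rfl
  let Q : S.boundaryH1 →ₗ[ℝ] (Fin d → ℝ) := P.domRestrict S.boundaryH1
  have hinj : Function.Injective Q := by
    rw [injective_iff_map_eq_zero]
    rintro ⟨x, hx⟩ hQ
    obtain ⟨α, rfl⟩ := Submodule.mkQ_surjective _ x
    have hα : α.1 ∈ S.boundaryForms := ⟨α, hx, rfl⟩
    have hex := hσ.isExactForm_of_periodMap_eq_zero hα hQ
    exact Subtype.ext ((Submodule.Quotient.mk_eq_zero _).2 hex)
  -- needed for the dimension count: `finrank` is also `0` in infinite dimension
  have := FiniteDimensional.of_injective Q hinj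
  have hsurj : Function.Surjective Q :=
    (LinearMap.injective_iff_surjective_of_finrank_eq_finrank
      (by rw [hσ.finrank_eq, Module.finrank_fin_fun])).1 hinj
  obtain ⟨⟨x, hx⟩, hxv⟩ := hsurj v
  obtain ⟨α, rfl⟩ := Submodule.mkQ_surjective _ x
  exact ⟨α, ⟨α, hx, rfl⟩, hxv⟩

variable {m : ℕ} {om : Fin m → OneForm (𝓡 (n + 1)) M}

/-! ### Rational and Liouville families -/

theorem IsAdapted.isRational_iff (hσ : S.IsAdapted σ) (hω : ∀ k, om k ∈ S.boundaryForms) :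
    S.IsRational om ↔ ∃ (ξ : Fin m → ℤ) (η : Fin d → ℤ), ξ ≠ 0 ∧
      ((periodMatrix σ om).mulVec fun k => (ξ k : ℝ)) = fun ℓ => (η ℓ : ℝ) := by
  have h : ∀ ξ : Fin m → ℤ, S.IsIntegral (combo ξ om) ↔ ∃ η : Fin d → ℤ,
      ((periodMatrix σ om).mulVec fun k => (ξ k : ℝ)) = fun ℓ => (η ℓ : ℝ) := fun ξ => by
    have hmem := S.combo_mem_boundaryForms hω ξ
    rw [← S.periodMap_combo σ hω]
    exact hσ.isIntegral_iff (α := ⟨combo ξ om, S.isClosedForm_of_mem_boundaryForms hmem⟩) hmem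
  simp only [IsRational, h, exists_and_left]

/-- The approximating integral forms `θ` differ from `ξ · om` by a combination of fixed forms with
unit periods whose coefficients are the entries of `η + A ξ`. -/
theorem IsAdapted.isLiouville_of_not_satisfiesDC (hσ : S.IsAdapted σ)
    (hω : ∀ k, om k ∈ S.boundaryForms) (hrat : ¬ S.IsRational om)
    (hDC : ¬ SatisfiesDC (periodMatrix σ om)) : S.IsLiouville om := by
  obtain ⟨ξ, η, hξ, hbd⟩ := exists_seq_of_not_satisfiesDC (periodMatrix σ om)
    (fun ξ η hξ h0 => hrat ((hσ.isRational_iff hω).2 ⟨ξ, -η, hξ, by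
      rw [eq_neg_of_add_eq_zero_right h0]
      ext ℓ
      simp⟩)) hDC
  choose φ hφ hφ1 using fun ℓ : Fin d => hσ.exists_periodMap_eq (Pi.single ℓ (1 : ℝ))
  let D : ℕ → Fin d → ℝ := fun j =>
    (fun ℓ => (η j ℓ : ℝ)) + (periodMatrix σ om).mulVec (fun k => (ξ j k : ℝ))
  refine ⟨hrat, fun j => combo (ξ j) om - ∑ ℓ, D j ℓ • (φ ℓ).1, ξ, fun j => ?_, hξ, ?_⟩
  · have hc := S.combo_mem_boundaryForms hω (ξ j)
    let Φ : closedForms (𝓡 (n + 1)) M :=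
      ⟨combo (ξ j) om, S.isClosedForm_of_mem_boundaryForms hc⟩ - ∑ ℓ, D j ℓ • φ ℓ
    have hΦ : Φ.1 = combo (ξ j) om - ∑ ℓ, D j ℓ • (φ ℓ).1 := by simp [Φ]
    have hmem : Φ.1 ∈ S.boundaryForms := by
      rw [hΦ]
      exact Submodule.sub_mem _ hc (Submodule.sum_mem _ fun ℓ _ => Submodule.smul_mem _ _ (hφ ℓ))
    beta_reduce
    rw [← hΦ]
    refine (hσ.isIntegral_iff hmem).2 ⟨-η j, ?_⟩
    have hsum : ∑ ℓ, D j ℓ • (Pi.single ℓ (1 : ℝ) : Fin d → ℝ) = D j := by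
      ext i
      simp [Finset.sum_apply, Pi.single_apply]
    simp only [Φ, map_sub, map_sum, map_smul, hφ1, hsum, S.periodMap_combo σ hω]
    ext ℓ
    simp [D]
  · have hb := isBoundedSeq_sum_smul (fun ℓ => (φ ℓ).1)
      (c := fun j ℓ => (euclNorm fun k => (ξ j k : ℝ)) ^ j * D j ℓ) (K := 1) fun j ℓ => by
        rw [abs_mul, abs_of_nonneg (pow_nonneg (euclNorm_nonneg _) _)]
        exact (mul_le_mul_of_nonneg_left (abs_apply_le_euclNorm _ ℓ)
          (pow_nonneg (euclNorm_nonneg _) _)).trans (hbd j)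
    convert hb using 2 with j
    rw [sub_sub_cancel, Finset.smul_sum]
    simp only [mul_smul]

/-- Integrating the bounded sequence over the cycles bounds `|ξ_j|^j |η_j + A ξ_j|`, where `-η_j` are
the periods of the approximating integral forms. -/
theorem IsAdapted.not_satisfiesDC_of_isLiouville (hσ : S.IsAdapted σ)
    (hω : ∀ k, om k ∈ S.boundaryForms) (hL : S.IsLiouville om) :
    ¬ SatisfiesDC (periodMatrix σ om) := by
  obtain ⟨_, θ, ξ, hθ, hξ, hbd⟩ := hL
  intro hDC
  have hθc : ∀ j, (θ j).IsClosedForm := fun j => S.isClosedForm_of_mem_boundaryForms (hθ j).1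
  choose η hη using fun j => (hσ.isIntegral_iff (α := ⟨θ j, hθc j⟩) (hθ j).1).1 (hθ j)
  choose C hC using fun ℓ : Fin d => hbd.exists_abs_chainIntegral_le (σ (Fin.castAdd e ℓ)).1
  refine hDC.not_superpolynomial (fun j => -η j) hξ
    (K := ∑ ℓ, 1 / (2 * Real.pi) * C ℓ) fun j => ?_
  set x := euclNorm fun k => (ξ j k : ℝ) with hx
  let Φ : closedForms (𝓡 (n + 1)) M := x ^ j • (⟨combo (ξ j) om,
    S.isClosedForm_of_mem_boundaryForms (S.combo_mem_boundaryForms hω (ξ j))⟩ - ⟨θ j, hθc j⟩)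
  have hΦ : periodMap σ Φ = x ^ j • ((fun ℓ => (((-η j) ℓ : ℤ) : ℝ)) +
      (periodMatrix σ om).mulVec (fun k => (ξ j k : ℝ))) := by
    simp only [Φ, map_smul, map_sub, S.periodMap_combo σ hω, hη]
    congr 1
    ext ℓ
    simp
    ring
  have hx0 : 0 ≤ x ^ j := pow_nonneg (euclNorm_nonneg _) _
  rw [← abs_of_nonneg hx0, ← euclNorm_smul, ← hΦ]
  refine (euclNorm_le_sum_abs _).trans (Finset.sum_le_sum fun ℓ _ => ?_)
  rw [periodMap_apply, abs_mul, abs_of_pos (by positivity)]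
  exact mul_le_mul_of_nonneg_left (hC ℓ j) (by positivity)

end ScatteringManifold

end

theorem mainTheorem4 {n m d e : ℕ} {Mbar M bM : Type*}
    [TopologicalSpace Mbar] [T2Space Mbar] [CompactSpace Mbar]
    [ChartedSpace (EuclideanHalfSpace (n + 1)) Mbar] [IsManifold (𝓡∂ (n + 1)) ∞ Mbar]
    [TopologicalSpace M] [ChartedSpace (EuclideanSpace ℝ (Fin (n + 1))) M]
    [IsManifold (𝓡 (n + 1)) ∞ M]
    [TopologicalSpace bM] [ChartedSpace (EuclideanSpace ℝ (Fin n)) bM]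
    [IsManifold (𝓡 n) ∞ bM]
    (S : ScatteringManifold n Mbar M bM)
    (σ : Fin (d + e) → OneCycle (𝓡 (n + 1)) M) (hσ : S.IsAdapted σ)
    (om : Fin m → OneForm (𝓡 (n + 1)) M) (hω : ∀ k, om k ∈ S.boundaryForms) :
    (S.IsRational om ↔
      (((fun ξ : Fin m → ℤ =>
          (ScatteringManifold.periodMatrix σ om).mulVec fun k => (ξ k : ℝ)) '' {ξ | ξ ≠ 0}) ∩
        Set.range fun (η : Fin d → ℤ) (ℓ : Fin d) => (η ℓ : ℝ)).Nonempty) ∧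
    (S.IsLiouville om ↔
      ¬ S.IsRational om ∧ ¬ SatisfiesDC (ScatteringManifold.periodMatrix σ om)) := by
  have hrat := hσ.isRational_iff hω
  refine ⟨hrat.trans ?_, fun hL => ⟨hL.1, hσ.not_satisfiesDC_of_isLiouville hω hL⟩,
    fun h => hσ.isLiouville_of_not_satisfiesDC hω h.1 h.2⟩
  constructor
  · rintro ⟨ξ, η, hξ, h⟩
    exact ⟨_, ⟨ξ, hξ, rfl⟩, η, h.symm⟩
  · rintro ⟨_, ⟨ξ, hξ, rfl⟩, η, h⟩
    exact ⟨ξ, η, hξ, h.symm⟩
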